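/- Fix integers $m,r\ge 1$ and reals $0<\rho\le H\le B$, $0<\delta<1$ and $c>0$. For each $n$ consider $n$ bidders and $m$ types of goods, with $k_j^n$ units of good $j$. *Valuations.* Each bidder $i$ has a valuation $v_i:\mathbb N^m\to[0,H]$ with $v_i(x)=v_i(\min\{x^1,r\},\dots,\min\{x^m,r\})$ for all $x$ and $v_i(x)\ge\rho$ for all $x\ne 0$ (no monotonicity is assumed). *Auction.* A strategy of a bidder $i$ is a choice, for each good $j$, of marginal bids $b_i^{j,1}\ge\dots\ge b_i^{j,r}$ in $[0,B)$; a marginal bid of $0$ is a null bid, which never wins a unit. Each bidder independently fails to arrive with probability $\delta$; the bids of a bidder who fails to arrive are replaced by null bids, and his value and utility are $0$. For each good $j$, the marginal bids are ordered decreasingly, ties being broken by a uniformly random order of the bidders (independent over the goods, the tying bids of one bidder being processed consecutively), and each positive bid among the first $k_j^n$ wins a unit. Every unit of good $j$ is sold at the price of the $(k_j^n+1)$-th highest marginal bid, i.e. the highest losing one ($0$ if there is none). Write $u_i^n(b;v_i)$ for the expected utility (value minus payment) of bidder $i$, $\mathcal R^n(b)$ for the expected revenue, $SW^n(b;v)$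 for the expected sum of the values of the arriving bidders for the bundles that they win, and $\mathrm{Opt}^n(v)$ for the expectation, over the arrivals, of the maximum of the sum of the values of the arriving bidders over all allocations of at most $k_j^n$ units of each good $j$. *Equilibrium.* Let $v_1,\dots,v_n$ be independent, $v_i\sim\mathcal F_i$. A profile of randomized strategies (Markov kernels from valuations to bids) is a Bayes-Nash equilibrium if for every $i$ and $\mathcal F_i$-almost every $v_i$ no fixed strategy gives bidder $i$ a higher expected utility, against the random valuations and bids of the others, than his equilibrium strategy. **Theorem.** There is a constant $C$, depending only on $m,r,\rho,H,B,\delta,c$, such that for every sequence of supplies with $k_j^n\ge c\,n$ for all $j$ and all sufficiently large $n$ the following hold. 1. The sequence of auctions is $(1,1)$-smooth in the large: for every $\varepsilon>0$ there is $n(\varepsilon)$ such that for every $n>n(\varepsilon)$ and every valuation profile $v$ there are strategies $s_1^*,\dots,s_n^*$ such that for every strategy profile $s$ $$\sum_{i=1}^n u_i^n(s_i^*,s_{-i};v_i)\ \ge\ (1-\varepsilon)\,\mathrm{Opt}^n(v)-\mathcal R^n(s).$$ 2. Full efficiency in the limit: for every $\varepsilon>0$ and all sufficiently large $n$, for all $\mathcal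 F_1,\dots,\mathcal F_n$, every Bayes-Nash equilibrium has expected welfare at least $(1-\varepsilon)\,\mathbb E_v[\mathrm{Opt}^n(v)]$. 3. Rate: for all sufficiently large $n$ and all $\mathcal F_1,\dots,\mathcal F_n$, every Bayes-Nash equilibrium has expected welfare at least $\left(1-\frac{C}{\sqrt n}\right)\mathbb E_v[\mathrm{Opt}^n(v)]$. -/

import Mathlib

open MeasureTheory ProbabilityTheory Filter

noncomputable section

/-! ### Mechanisms, smoothness in the large, Bayes-Nash equilibria -/

/-- The data of a (possibly randomized) mechanism with `n` players, strategy space `S` and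
valuation space `V` that enter the notions below. All quantities are expectations over the internal
randomness of the mechanism. -/
structure Mechanism (n : ℕ) (S V : Type) where
  /-- `utility i s vᵢ` is the utility of player `i` with valuation `vᵢ` at the profile `s` -/
  utility : Fin n → (Fin n → S) → V → ℝ
  /-- total payment collected at a strategy profile -/
  revenue : (Fin n → S) → ℝ
  /-- social welfare at a strategy profile -/
  welfare : (Fin n → S) → (Fin n → V) → ℝ
  /-- optimal social welfare for a valuation profile -/
  optimum : (Fin n → V) → ℝ

/-- `(lam, mu)`-smoothness in the large of a sequence of mechanisms: the deviations `sStar` may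
depend on the valuation profile, but not on the strategy profile `s`. -/
def SmoothInTheLarge {S V : Type} (M : (n : ℕ) → Mechanism n S V) (lam mu : ℝ) : Prop :=
  ∀ ε : ℝ, 0 < ε → ∃ N : ℕ, ∀ n : ℕ, N < n → ∀ v : Fin n → V,
    ∃ sStar : Fin n → S, ∀ s : Fin n → S,
      lam * (1 - ε) * (M n).optimum v - mu * (M n).revenue s
        ≤ ∑ i, (M n).utility i (Function.update s i (sStar i)) (v i)

section Equilibrium

variable {n : ℕ} {S V : Type} [MeasurableSpace S] [MeasurableSpace V]

/-- The joint law of the pairs (valuation, strategy) of all players, when the valuation of player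
`i` is drawn from `F i`, independently over the players, and player `i` then draws a strategy from
`σ i vᵢ`. -/
def playLaw (F : Fin n → Measure V) (σ : Fin n → Kernel V S) : Measure (Fin n → V × S) :=
  Measure.pi fun i => F i ⊗ₘ σ i

/-- Bayes-Nash equilibrium: for almost every own valuation `vi`, no alternative strategy `s'` gives
player `i` a larger expected utility, against the other players' random valuations and strategies,
than the randomized strategy `σ i vi`. -/
def IsBayesNash (M : Mechanism n S V) (F : Fin n → Measure V) (σ : Fin n → Kernel V S) : Prop :=
  ∀ i : Fin n, ∀ᵐ vi ∂(F i), ∀ s' : S,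
    ∫ ω, M.utility i (Function.update (fun j => (ω j).2) i s') vi ∂(playLaw F σ)
      ≤ ∫ ω, (∫ s, M.utility i (Function.update (fun j => (ω j).2) i s) vi ∂(σ i vi))
          ∂(playLaw F σ)

/-- Every Bayes-Nash equilibrium, for every profile of independent valuation distributions, has
expected welfare at least the fraction `α` of the expected optimal welfare. -/
def BayesNashEfficiency (M : Mechanism n S V) (α : ℝ) : Prop :=
  ∀ (F : Fin n → Measure V) (σ : Fin n → Kernel V S),
    (∀ i, IsProbabilityMeasure (F i)) → (∀ i, IsMarkovKernel (σ i)) → IsBayesNash M F σ →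
      α * ∫ v, M.optimum v ∂(Measure.pi F)
        ≤ ∫ ω, M.welfare (fun i => (ω i).2) (fun i => (ω i).1) ∂(playLaw F σ)

end Equilibrium

/-! ### Simultaneous uniform price auctions -/

/-- The valuations of bundles of `m` goods: with values in `[0, H]`, with demand at most `r` units of
each good, and with value at least `ρ` for every nonzero bundle. -/
abbrev BundleValuation (m r : ℕ) (ρ H : ℝ) : Type :=
  {v : (Fin m → ℕ) → ℝ //
    (∀ x, 0 ≤ v x ∧ v x ≤ H) ∧ (∀ x, v x = v fun j => min (x j) r) ∧ ∀ x, x ≠ 0 → ρ ≤ v x}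

/-- The bids of one player: for each of the `m` goods, `r` nonincreasing marginal bids in `[0, B)`.
A marginal bid of `0` is the null bid: it never wins a unit. -/
abbrev BidVector (m r : ℕ) (B : ℝ) : Type :=
  {b : Fin m → Fin r → ℝ // ∀ j, Antitone (b j) ∧ ∀ x, 0 ≤ b j x ∧ b j x < B}

section Auction

variable {n m r : ℕ}

/-- `beats π β p q`: in the auction of one good with marginal bids `β` (indexed by player and number
of the marginal bid), the marginal bid `p` comes before the marginal bid `q`. Higher bids come
first; ties between players are resolved by the order `π` in which the players are processed, ties
between bids of the same player by the number of the bid. -/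
def beats (π : Equiv.Perm (Fin n)) (β : Fin n → Fin r → ℝ) (p q : Fin n × Fin r) : Prop :=
  β q.1 q.2 < β p.1 p.2 ∨
    (β p.1 p.2 = β q.1 q.2 ∧ (π p.1 < π q.1 ∨ (p.1 = q.1 ∧ p.2 < q.2)))

open Classical in
/-- The number of units that player `i` wins when `k` units of the good are sold: the number of
positive marginal bids of `i` that are among the first `k` bids. -/
def unitsWon (k : ℕ) (π : Equiv.Perm (Fin n)) (β : Fin n → Fin r → ℝ) (i : Fin n) : ℕ :=
  (Finset.univ.filter fun x : Fin r =>
    0 < β i x ∧ (Finset.univ.filter fun p : Fin n × Fin r => beats π β p (i, x)).card < k).card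

/-- The price per unit when `k` units of the good are sold: the `(k+1)`-th highest marginal bid, that
is the highest losing one (`0` if there are at most `k` bids). -/
def unitPrice (k : ℕ) (β : Fin n → Fin r → ℝ) : ℝ :=
  (((Finset.univ : Finset (Fin n × Fin r)).val.map fun p => β p.1 p.2).sort (· ≥ ·)).getD k 0

/-- The marginal bids for good `j` when only the players `i` with `z i = true` arrive: the bids of
the other players are replaced by null bids. -/
def arrivingBids {B : ℝ} (b : Fin n → BidVector m r B) (z : Fin n → Bool) (j : Fin m) :
    Fin n → Fin r → ℝ :=
  fun i x => if z i then (b i).1 j x else 0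

/-- The bundle won by player `i`, for supplies `k`, processing orders `π` and arrivals `z`. -/
def bundleWon {B : ℝ} (k : Fin m → ℕ) (b : Fin n → BidVector m r B) (z : Fin n → Bool)
    (π : Fin m → Equiv.Perm (Fin n)) (i : Fin n) : Fin m → ℕ :=
  fun j => unitsWon (k j) (π j) (arrivingBids b z j) i

/-- The total payment of player `i`, for supplies `k`, processing orders `π` and arrivals `z`. -/
def payment {B : ℝ} (k : Fin m → ℕ) (b : Fin n → BidVector m r B) (z : Fin n → Bool)
    (π : Fin m → Equiv.Perm (Fin n)) (i : Fin n) : ℝ :=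
  ∑ j, (bundleWon k b z π i j : ℝ) * unitPrice (k j) (arrivingBids b z j)

/-- Expectation over the arrivals, where each of the `n` players independently fails to arrive with
probability `δ`. -/
def arrivalExpectation (δ : ℝ) (f : (Fin n → Bool) → ℝ) : ℝ :=
  ∑ z, (∏ i, if z i then 1 - δ else δ) * f z

/-- Expectation over the processing orders of the players, which are uniformly random and
independent over the goods. -/
def orderExpectation (f : (Fin m → Equiv.Perm (Fin n)) → ℝ) : ℝ :=
  (∑ π, f π) / Fintype.card (Fin m → Equiv.Perm (Fin n))

/-- The optimal welfare when the supplies are `k` and the players with `z i = true` arrive. -/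
def optimalWelfare {ρ H : ℝ} (k : Fin m → ℕ) (v : Fin n → BundleValuation m r ρ H)
    (z : Fin n → Bool) : ℝ :=
  ⨆ x : {x : Fin n → Fin m → ℕ // ∀ j, ∑ i, x i j ≤ k j},
    ∑ i, if z i then (v i).1 (x.1 i) else 0

end Auction

/-- The simultaneous uniform price auction of `k j` units of each good `j` among `n` players, each of
whom independently fails to arrive with probability `δ`. -/
def noisyUniformPriceAuction (n m r : ℕ) (ρ H B δ : ℝ) (k : Fin m → ℕ) :
    Mechanism n (BidVector m r B) (BundleValuation m r ρ H) where
  utility i b vi := arrivalExpectation δ fun z => orderExpectation fun π =>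
    if z i then vi.1 (bundleWon k b z π i) - payment k b z π i else 0
  revenue b := arrivalExpectation δ fun z => orderExpectation fun π =>
    ∑ i, payment k b z π i
  welfare b v := arrivalExpectation δ fun z => orderExpectation fun π =>
    ∑ i, if z i then (v i).1 (bundleWon k b z π i) else 0
  optimum v := arrivalExpectation δ fun z => optimalWelfare k v z

end

/-!
The auction is `(1, 1)`-smooth up to an additive error of order `√n`, while the optimal welfare is
of order `n` (`linear_le_optimum`); all three conclusions follow.

*Smoothness* (`exists_smooth_deviation`). Fix the valuations. Player `i` deviates by bidding
almost `B` on each unit of a bundle `d i` that does not depend on the bids of the others. If he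
loses one of these units, the price is almost `B ≥ H` and buying the bundle would not have been
worthwhile, so his utility is always at least that of buying `d i` at the prices that result from
his deviation, up to a negligible error (`flatBid_utility_ge`). The bundles come from sampling:
each player draws fresh arrivals of the others and requests his bundle of an optimal allocation
for these arrivals. On average this yields the optimal welfare and respects the supplies, and a
second moment argument fixes the sample at the cost of an error of order `√n`
(`exists_deterministic_allocation`). As the revenue is at least the sum of supply times price over
the goods (`sum_mul_unitPrice_le_revenue`), smoothness would follow if the deviation of a player
did not change the prices.

*Price impact.* A deviation moves the price by at most `r` ranks in the list of all marginal bids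
(`unitPrice_le_of_eq_off`), so the gaps between consecutive order statistics have to be small in
expectation. Each of the players who own one of the `a + 1` highest bids, at least `(a + 1) / r`
in number, lowers the `(a + 1)`-th highest bid to at most the `(a + 2)`-th by not arriving; hence
the gap is at most `r / (a + 1)` times the total influence of the arrivals on the order statistic
(`unitPrice_gap_le`). The expected total influence of independent arrivals on a bounded function
is proportional to its covariance with the number of arriving players, so it is of order at most
`√n` (`sum_influence_le`). With supplies of order at least `n`, the expected price changes by
`O(1 / √n)`.

*Equilibria* (`integral_welfare_ge`). For a fixed valuation profile `v`, the equilibrium condition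
compares each player `i` with valuation `v i` to his deviation, against strategies of the others
drawn afresh; the smoothness inequality for the fresh profile bounds the sum of the deviation
utilities. Integrating over `v`, and adding the revenue to the sum of the utilities, bounds the
expected welfare from below.
-/

/-! ### Order statistics of the bids for one good -/

section SingleGood

variable {n r : ℕ}

open Classical in
/-- The marginal bids (indexed by player and number of the bid) that are at least `b`. -/
noncomputable def bidsAtLeast (β : Fin n → Fin r → ℝ) (b : ℝ) : Finset (Fin n × Fin r) :=
  Finset.univ.filter fun p => b ≤ β p.1 p.2

@[simp] lemma mem_bidsAtLeast {β : Fin n → Fin r → ℝ} {b : ℝ} {p : Fin n × Fin r} :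
    p ∈ bidsAtLeast β b ↔ b ≤ β p.1 p.2 := by
  simp [bidsAtLeast]

lemma List.le_getD_iff_lt_countP {l : List ℝ} (hl : l.Pairwise (· ≥ ·)) {b : ℝ} (hb : 0 < b)
    (a : ℕ) : b ≤ l.getD a 0 ↔ a < l.countP (fun x => decide (b ≤ x)) := by
  induction l generalizing a with
  | nil => simp [hb]
  | cons y l ih =>
    rw [List.pairwise_cons] at hl
    by_cases hy : b ≤ y
    · rw [List.countP_cons_of_pos (by simpa using hy)]
      cases a with
      | zero => simp [hy]
      | succ a => simpa using ih hl.2 a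
    · have h0 : ∀ x ∈ l, ¬ b ≤ x := fun x hx h => hy (h.trans (hl.1 x hx))
      rw [List.countP_cons_of_neg (by simpa using hy), List.countP_eq_zero.2 (by simpa using h0)]
      cases a with
      | zero => simpa using hy
      | succ a =>
        have := ih hl.2 a
        rw [List.countP_eq_zero.2 (by simpa using h0)] at this
        simpa using this

/-- The unit price is an order statistic: it is at least `b > 0` exactly if more than `a` marginal
bids are. All other facts about prices are derived from this one. -/
lemma le_unitPrice_iff {β : Fin n → Fin r → ℝ} {a : ℕ} {b : ℝ} (hb : 0 < b) :
    b ≤ unitPrice a β ↔ a < (bidsAtLeast β b).card := by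
  classical
  unfold unitPrice
  rw [List.le_getD_iff_lt_countP (Multiset.pairwise_sort _ _) hb, ← Multiset.coe_countP,
    Multiset.sort_eq, Multiset.countP_map, ← Finset.filter_val]
  simp only [bidsAtLeast, Finset.card]

lemma unitPrice_nonneg {β : Fin n → Fin r → ℝ} (hβ : ∀ i x, 0 ≤ β i x) (a : ℕ) :
    0 ≤ unitPrice a β := by
  unfold unitPrice
  rw [List.getD_eq_getElem?_getD]
  rcases h : (Multiset.sort _ _)[a]? with _ | y
  · simp
  · have hy := List.mem_of_getElem? h
    rw [Multiset.mem_sort, Multiset.mem_map] at hy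
    obtain ⟨p, -, rfl⟩ := hy
    exact hβ _ _

lemma unitPrice_le_unitPrice {n' r' : ℕ} {β : Fin n → Fin r → ℝ} {β' : Fin n' → Fin r' → ℝ}
    {a a' : ℕ} (hβ' : ∀ i x, 0 ≤ β' i x)
    (h : ∀ b, 0 < b → a < (bidsAtLeast β b).card → a' < (bidsAtLeast β' b).card) :
    unitPrice a β ≤ unitPrice a' β' := by
  rcases le_or_gt (unitPrice a β) 0 with h0 | h0
  · exact h0.trans (unitPrice_nonneg hβ' a')
  · exact (le_unitPrice_iff h0).2 (h _ h0 ((le_unitPrice_iff h0).1 le_rfl))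

lemma unitPrice_le {β : Fin n → Fin r → ℝ} {B : ℝ} (hB : 0 ≤ B) (hβ : ∀ i x, β i x ≤ B) (a : ℕ) :
    unitPrice a β ≤ B := by
  by_contra! h
  have h0 := hB.trans_lt h
  obtain ⟨p, hp⟩ := Finset.card_pos.1 ((Nat.zero_le a).trans_lt ((le_unitPrice_iff h0).1 le_rfl))
  exact absurd ((mem_bidsAtLeast.1 hp).trans (hβ _ _)) (not_le.2 h)

lemma unitPrice_anti {β : Fin n → Fin r → ℝ} (hβ : ∀ i x, 0 ≤ β i x) :
    Antitone fun a => unitPrice a β :=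
  fun _ _ haa => unitPrice_le_unitPrice hβ fun _ _ h => haa.trans_lt h

lemma unitPrice_mono {β β' : Fin n → Fin r → ℝ} (hβ' : ∀ i x, 0 ≤ β' i x)
    (h : ∀ i x, β i x ≤ β' i x) (a : ℕ) : unitPrice a β ≤ unitPrice a β' :=
  unitPrice_le_unitPrice hβ' fun _ _ hc => hc.trans_le <| Finset.card_le_card fun p hp => by
    rw [mem_bidsAtLeast] at hp ⊢
    exact hp.trans (h _ _)

/-- Changing the bids of one player moves the price by at most `r` ranks. -/
lemma unitPrice_le_of_eq_off {β β' : Fin n → Fin r → ℝ} (hβ' : ∀ i x, 0 ≤ β' i x) {i : Fin n}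
    (h : ∀ l, l ≠ i → β l = β' l) {a : ℕ} (ha : r ≤ a) :
    unitPrice a β ≤ unitPrice (a - r) β' := by
  classical
  refine unitPrice_le_unitPrice hβ' fun b _ hc => ?_
  have hsub : bidsAtLeast β b ⊆ bidsAtLeast β' b ∪ ({i} : Finset (Fin n)) ×ˢ Finset.univ := by
    intro p hp
    by_cases hpi : p.1 = i
    · exact Finset.mem_union_right _
        (Finset.mem_product.2 ⟨by simpa using hpi, Finset.mem_univ _⟩)
    · refine Finset.mem_union_left _ ?_
      rw [mem_bidsAtLeast] at hp ⊢
      rwa [← h _ hpi]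
  have := (Finset.card_le_card hsub).trans (Finset.card_union_le _ _)
  simp at this
  omega

lemma update_zero_bounds {β : Fin n → Fin r → ℝ} (hβ : ∀ i x, 0 ≤ β i x) (i : Fin n) (l : Fin n)
    (x : Fin r) : 0 ≤ Function.update β i 0 l x ∧ Function.update β i 0 l x ≤ β l x := by
  by_cases h : l = i
  · subst h; simp [hβ]
  · simp [h, hβ]

/-- The gap between consecutive order statistics is controlled by the influences of the players on
the price: each of the at least `(a + 1) / r` players owning one of the `a + 1` highest bids lowers
the `(a + 1)`-th highest bid to at most the `(a + 2)`-th when his bids are removed. -/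
lemma unitPrice_gap_le {β : Fin n → Fin r → ℝ} (hβ : ∀ i x, 0 ≤ β i x) (a : ℕ) :
    ((a : ℝ) + 1) * (unitPrice a β - unitPrice (a + 1) β) ≤
      r * ∑ i, (unitPrice a β - unitPrice a (Function.update β i 0)) := by
  classical
  set w := unitPrice a β with hw
  have hmono : ∀ i, unitPrice a (Function.update β i 0) ≤ w := fun i =>
    unitPrice_mono hβ (fun l x => (update_zero_bounds hβ i l x).2) a
  have hgap : 0 ≤ w - unitPrice (a + 1) β := sub_nonneg.2 (unitPrice_anti hβ (Nat.le_succ a))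
  rcases (unitPrice_nonneg hβ a).eq_or_lt with h0 | h0
  · have h1 : w - unitPrice (a + 1) β = 0 := by
      have := unitPrice_nonneg hβ (a + 1)
      linarith
    rw [h1, mul_zero]
    exact mul_nonneg (Nat.cast_nonneg _) (Finset.sum_nonneg fun i _ => sub_nonneg.2 (hmono i))
  set I := (bidsAtLeast β w).image Prod.fst with hI
  have hcard : a + 1 ≤ r * I.card := by
    have h1 : a < (bidsAtLeast β w).card := (le_unitPrice_iff h0).1 le_rfl
    have h2 : bidsAtLeast β w ⊆ I ×ˢ Finset.univ := fun p hp =>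
      Finset.mem_product.2 ⟨Finset.mem_image_of_mem Prod.fst hp, Finset.mem_univ _⟩
    have h3 := Finset.card_le_card h2
    rw [Finset.card_product, Finset.card_univ, Fintype.card_fin, mul_comm] at h3
    omega
  have hinf : ∀ i ∈ I, unitPrice a (Function.update β i 0) ≤ unitPrice (a + 1) β := by
    intro i hi
    set b := unitPrice a (Function.update β i 0) with hb
    rcases le_or_gt b 0 with hb0 | hb0
    · exact hb0.trans (unitPrice_nonneg hβ _)
    rw [le_unitPrice_iff hb0]
    have h1 : a < (bidsAtLeast (Function.update β i 0) b).card := (le_unitPrice_iff hb0).1 le_rfl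
    obtain ⟨p, hp, rfl⟩ := Finset.mem_image.1 hi
    have h2 : bidsAtLeast (Function.update β p.1 0) b ⊂ bidsAtLeast β b := by
      refine Finset.ssubset_iff_of_subset (fun q hq => ?_) |>.2 ⟨p, ?_, ?_⟩
      · rw [mem_bidsAtLeast] at hq ⊢
        exact hq.trans (update_zero_bounds hβ _ _ _).2
      · rw [mem_bidsAtLeast] at hp ⊢
        exact (hmono p.1).trans hp
      · simpa using hb0
    exact lt_of_le_of_lt h1 (Finset.card_lt_card h2)
  calc ((a : ℝ) + 1) * (w - unitPrice (a + 1) β)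
      ≤ (r * I.card) * (w - unitPrice (a + 1) β) := by
        gcongr
        exact_mod_cast hcard
    _ = r * ∑ i ∈ I, (w - unitPrice (a + 1) β) := by
        rw [Finset.sum_const, nsmul_eq_mul, mul_assoc]
    _ ≤ r * ∑ i ∈ I, (w - unitPrice a (Function.update β i 0)) := by
        gcongr with i hi
        exact hinf i hi
    _ ≤ r * ∑ i, (w - unitPrice a (Function.update β i 0)) := by
        gcongr
        · exact fun i _ _ => sub_nonneg.2 (hmono i)
        · exact Finset.subset_univ _

/-! ### Allocation and revenue of one good -/

lemma beats_irrefl (π : Equiv.Perm (Fin n)) (β : Fin n → Fin r → ℝ) (p : Fin n × Fin r) :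
    ¬ beats π β p p := by
  simp [beats]

lemma beats_trans {π : Equiv.Perm (Fin n)} {β : Fin n → Fin r → ℝ} {p q s : Fin n × Fin r}
    (h : beats π β p q) (h' : beats π β q s) : beats π β p s := by
  unfold beats at *
  rcases h with h | ⟨h, h1⟩ <;> rcases h' with h' | ⟨h', h2⟩
  · exact .inl (h'.trans h)
  · exact .inl (h' ▸ h)
  · exact .inl (h ▸ h')
  · refine .inr ⟨h.trans h', ?_⟩
    rcases h1 with h1 | ⟨e1, h1⟩ <;> rcases h2 with h2 | ⟨e2, h2⟩
    · exact .inl (h1.trans h2)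
    · exact .inl (e2 ▸ h1)
    · exact .inl (e1 ▸ h2)
    · exact .inr ⟨e1.trans e2, h1.trans h2⟩

lemma beats_total {π : Equiv.Perm (Fin n)} {β : Fin n → Fin r → ℝ} {p q : Fin n × Fin r}
    (h : p ≠ q) : beats π β p q ∨ beats π β q p := by
  unfold beats
  rcases lt_trichotomy (β p.1 p.2) (β q.1 q.2) with h1 | h1 | h1
  · exact .inr (.inl h1)
  · by_cases h2 : p.1 = q.1
    · have h3 : p.2 ≠ q.2 := fun e => h (Prod.ext h2 e)
      rcases h3.lt_or_gt with h3 | h3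
      · exact .inl (.inr ⟨h1, .inr ⟨h2, h3⟩⟩)
      · exact .inr (.inr ⟨h1.symm, .inr ⟨h2.symm, h3⟩⟩)
    · have h3 : π p.1 ≠ π q.1 := fun e => h2 (π.injective e)
      rcases h3.lt_or_gt with h3 | h3
      · exact .inl (.inr ⟨h1, .inl h3⟩)
      · exact .inr (.inr ⟨h1.symm, .inl h3⟩)
  · exact .inl (.inl h1)

open Classical in
/-- The number of marginal bids that come before `p`. -/
noncomputable def bidRank (π : Equiv.Perm (Fin n)) (β : Fin n → Fin r → ℝ)
    (p : Fin n × Fin r) : ℕ :=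
  (Finset.univ.filter fun q => beats π β q p).card

lemma unitsWon_eq (k : ℕ) (π : Equiv.Perm (Fin n)) (β : Fin n → Fin r → ℝ) (i : Fin n) :
    unitsWon k π β i =
      (Finset.univ.filter fun x : Fin r => 0 < β i x ∧ bidRank π β (i, x) < k).card := by
  unfold unitsWon bidRank
  congr

lemma bidRank_lt_of_beats {π : Equiv.Perm (Fin n)} {β : Fin n → Fin r → ℝ} {p q : Fin n × Fin r}
    (h : beats π β p q) : bidRank π β p < bidRank π β q := by
  classical
  refine Finset.card_lt_card ?_
  refine Finset.ssubset_iff_of_subset (fun s hs => ?_) |>.2 ⟨p, by simpa using h, ?_⟩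
  · simp only [Finset.mem_filter, Finset.mem_univ, true_and] at hs ⊢
    exact beats_trans hs h
  · simpa using beats_irrefl π β p

lemma bidRank_injective (π : Equiv.Perm (Fin n)) (β : Fin n → Fin r → ℝ) :
    Function.Injective (bidRank π β) := by
  intro p q h
  by_contra hne
  rcases beats_total (π := π) (β := β) hne with h1 | h1
  · exact absurd h (bidRank_lt_of_beats h1).ne
  · exact absurd h (bidRank_lt_of_beats h1).ne'

lemma bidRank_lt_card (π : Equiv.Perm (Fin n)) (β : Fin n → Fin r → ℝ) (p : Fin n × Fin r) :
    bidRank π β p < Fintype.card (Fin n × Fin r) := by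
  classical
  refine Finset.card_lt_card (Finset.ssubset_iff_of_subset (Finset.subset_univ _) |>.2
    ⟨p, Finset.mem_univ _, ?_⟩)
  simpa using beats_irrefl π β p

/-- The ranks of the bids are exactly `0, 1, …`, so `k` bids have rank below `k`. -/
lemma card_bidRank_lt (π : Equiv.Perm (Fin n)) (β : Fin n → Fin r → ℝ) {k : ℕ}
    (hk : k ≤ Fintype.card (Fin n × Fin r)) :
    (Finset.univ.filter fun p => bidRank π β p < k).card = k := by
  classical
  have himg : Finset.univ.image (bidRank π β) = Finset.range (Fintype.card (Fin n × Fin r)) := by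
    refine Finset.eq_of_subset_of_card_le (fun a ha => ?_) ?_
    · obtain ⟨p, -, rfl⟩ := Finset.mem_image.1 ha
      exact Finset.mem_range.2 (bidRank_lt_card π β p)
    · rw [Finset.card_image_of_injective _ (bidRank_injective π β)]
      simp
  rw [← Finset.card_image_of_injective _ (bidRank_injective π β)]
  have : (Finset.univ.filter fun p => bidRank π β p < k).image (bidRank π β) = Finset.range k := by
    ext a
    simp only [Finset.mem_image, Finset.mem_filter, Finset.mem_univ, true_and, Finset.mem_range]
    constructor
    · rintro ⟨p, hp, rfl⟩
      exact hp
    · intro ha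
      have : a ∈ Finset.univ.image (bidRank π β) := by
        rw [himg]
        exact Finset.mem_range.2 (ha.trans_le hk)
      obtain ⟨p, -, rfl⟩ := Finset.mem_image.1 this
      exact ⟨p, ha, rfl⟩
  rw [this, Finset.card_range]

/-- If the price is positive, all units are sold. -/
lemma mul_unitPrice_le_sum {β : Fin n → Fin r → ℝ} (hβ : ∀ i x, 0 ≤ β i x) (k : ℕ)
    (π : Equiv.Perm (Fin n)) :
    (k : ℝ) * unitPrice k β ≤ ∑ i, (unitsWon k π β i : ℝ) * unitPrice k β := by
  classical
  rcases (unitPrice_nonneg hβ k).eq_or_lt with h0 | h0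
  · simp [← h0]
  set w := unitPrice k β
  have hk : k < (bidsAtLeast β w).card := (le_unitPrice_iff h0).1 le_rfl
  -- a winning bid is positive, since a null bid is beaten by the more than `k` positive ones
  have hpos : ∀ p, bidRank π β p < k → 0 < β p.1 p.2 := by
    intro p hp
    by_contra! hle
    refine absurd (Finset.card_le_card (s := bidsAtLeast β w) fun q hq => ?_)
      (not_le.2 (hp.trans hk))
    simp only [mem_bidsAtLeast] at hq
    simp only [Finset.mem_filter, Finset.mem_univ, true_and]
    exact .inl (hle.trans_lt (h0.trans_le hq))
  rw [← Finset.sum_mul]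
  gcongr
  have hsum : ∑ i, unitsWon k π β i = k := by
    have h1 := card_bidRank_lt π β (k := k) (hk.le.trans (Finset.card_le_univ _))
    simp only [unitsWon_eq, Finset.card_filter]
    rw [Finset.card_filter, Fintype.sum_prod_type] at h1
    refine (Finset.sum_congr rfl fun i _ => Finset.sum_congr rfl fun x _ => ?_).trans h1
    by_cases hr : bidRank π β (i, x) < k
    · simp [hr, hpos (i, x) hr]
    · simp [hr]
  exact_mod_cast hsum.ge

lemma unitsWon_le (k : ℕ) (π : Equiv.Perm (Fin n)) (β : Fin n → Fin r → ℝ) (i : Fin n) :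
    unitsWon k π β i ≤ r := by
  rw [unitsWon_eq]
  exact (Finset.card_le_univ _).trans (by simp)

/-- A player who bids `b` on `d` units and null on the others wins at most `d` units, and wins all
`d` of them unless the price is at least `b`. -/
lemma unitsWon_of_flat_row {β : Fin n → Fin r → ℝ} {i : Fin n} {d : ℕ} (hd : d ≤ r)
    {b : ℝ} (hb : 0 < b)
    (hi : ∀ x : Fin r, β i x = if (x : ℕ) < d then b else 0) (k : ℕ) (π : Equiv.Perm (Fin n)) :
    unitsWon k π β i ≤ d ∧ (unitsWon k π β i < d → b ≤ unitPrice k β) := by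
  classical
  have hcard : (Finset.univ.filter fun x : Fin r => (x : ℕ) < d).card = d := by
    rw [Fin.card_filter_val_lt, min_eq_right hd]
  rw [unitsWon_eq]
  have hsub : (Finset.univ.filter fun x : Fin r => 0 < β i x ∧ bidRank π β (i, x) < k) ⊆
      Finset.univ.filter fun x : Fin r => (x : ℕ) < d := by
    intro x hx
    simp only [Finset.mem_filter, Finset.mem_univ, true_and] at hx ⊢
    by_contra h
    simp [hi, h] at hx
  refine ⟨(Finset.card_le_card hsub).trans hcard.le, fun hlt => ?_⟩
  obtain ⟨x, hx, hx'⟩ := Finset.exists_mem_notMem_of_card_lt_card (hlt.trans_eq hcard.symm)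
  simp only [Finset.mem_filter, Finset.mem_univ, true_and] at hx hx'
  have hbx : β i x = b := by simp [hi, hx]
  have hk : k ≤ bidRank π β (i, x) := by
    by_contra! h
    exact hx' ⟨hbx ▸ hb, h⟩
  rw [le_unitPrice_iff hb]
  refine hk.trans_lt (Finset.card_lt_card ?_)
  refine Finset.ssubset_iff_of_subset (fun q hq => ?_) |>.2
    ⟨(i, x), by simp [hbx], by simpa using beats_irrefl π β (i, x)⟩
  simp only [Finset.mem_filter, Finset.mem_univ, true_and, mem_bidsAtLeast] at hq ⊢
  rcases hq with hq | ⟨hq, -⟩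
  · exact hbx ▸ hq.le
  · exact hbx ▸ hq.ge

end SingleGood

/-! ### Expectations over the arrivals -/

section Arrivals

variable {n : ℕ} {δ : ℝ}

lemma arrivalExpectation_add (f g : (Fin n → Bool) → ℝ) :
    arrivalExpectation δ (fun z => f z + g z) =
      arrivalExpectation δ f + arrivalExpectation δ g := by
  simp only [arrivalExpectation, mul_add, Finset.sum_add_distrib]

lemma arrivalExpectation_sub (f g : (Fin n → Bool) → ℝ) :
    arrivalExpectation δ (fun z => f z - g z) =
      arrivalExpectation δ f - arrivalExpectation δ g := by
  simp only [arrivalExpectation, mul_sub, Finset.sum_sub_distrib]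

lemma arrivalExpectation_const_mul (c : ℝ) (f : (Fin n → Bool) → ℝ) :
    arrivalExpectation δ (fun z => c * f z) = c * arrivalExpectation δ f := by
  simp only [arrivalExpectation, Finset.mul_sum, mul_left_comm]

lemma arrivalExpectation_sum {ι : Type*} (s : Finset ι) (f : ι → (Fin n → Bool) → ℝ) :
    arrivalExpectation δ (fun z => ∑ i ∈ s, f i z) = ∑ i ∈ s, arrivalExpectation δ (f i) := by
  simp only [arrivalExpectation, Finset.mul_sum]
  exact Finset.sum_comm

lemma arrivalWeight_nonneg (hδ0 : 0 ≤ δ) (hδ1 : δ ≤ 1) (z : Fin n → Bool) :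
    0 ≤ ∏ i, if z i then 1 - δ else δ :=
  Finset.prod_nonneg fun i _ => by split_ifs <;> linarith

lemma arrivalExpectation_mono (hδ0 : 0 ≤ δ) (hδ1 : δ ≤ 1) {f g : (Fin n → Bool) → ℝ}
    (h : ∀ z, f z ≤ g z) : arrivalExpectation δ f ≤ arrivalExpectation δ g :=
  Finset.sum_le_sum fun z _ => mul_le_mul_of_nonneg_left (h z) (arrivalWeight_nonneg hδ0 hδ1 z)

lemma sum_arrivalWeight : ∑ z : Fin n → Bool, ∏ i, (if z i then 1 - δ else δ) = 1 := by
  have h := Finset.prod_univ_sum (fun _ : Fin n => (Finset.univ : Finset Bool))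
    (fun _ b => if b then 1 - δ else δ)
  rw [Fintype.piFinset_univ] at h
  rw [← h]
  simp

lemma arrivalExpectation_const (c : ℝ) :
    arrivalExpectation δ (fun _ : Fin n → Bool => c) = c := by
  rw [arrivalExpectation, ← Finset.sum_mul, sum_arrivalWeight, one_mul]

lemma arrivalWeight_update (z : Fin n → Bool) (i : Fin n) (b : Bool) :
    (∏ l, if Function.update z i b l then 1 - δ else δ) =
      (if b then 1 - δ else δ) * ∏ l ∈ Finset.univ.erase i, if z l then 1 - δ else δ := by
  rw [← Finset.mul_prod_erase _ _ (Finset.mem_univ i), Function.update_self]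
  congr 1
  exact Finset.prod_congr rfl fun l hl => by
    rw [Function.update_of_ne (Finset.ne_of_mem_erase hl)]

/-- Conditioning on the arrival of player `i`. -/
lemma arrivalExpectation_cond (i : Fin n) (f : (Fin n → Bool) → ℝ) :
    arrivalExpectation δ f =
      (1 - δ) * arrivalExpectation δ (fun z => f (Function.update z i true)) +
        δ * arrivalExpectation δ (fun z => f (Function.update z i false)) := by
  rw [← arrivalExpectation_const_mul, ← arrivalExpectation_const_mul, ← arrivalExpectation_add]
  have hflip : Function.Involutive fun z : Fin n → Bool => Function.update z i (!z i) := fun z => by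
    simp
  -- both sides agree after symmetrization under the flip of coordinate `i`
  have hsymm : ∀ g : (Fin n → Bool) → ℝ, ∑ z, g z + ∑ z, g z =
      ∑ z, (g z + g (Function.update z i (!z i))) := fun g => by
    rw [Finset.sum_add_distrib]
    congr 1
    exact (Equiv.sum_comp hflip.toPerm g).symm
  have key : ∀ F G : ℝ, F + F = G + G → F = G := fun F G h => by linarith
  refine key _ _ ?_
  unfold arrivalExpectation
  rw [hsymm, hsymm]
  refine Finset.sum_congr rfl fun z _ => ?_
  have hw : (∏ l, if z l then 1 - δ else δ) = _ :=
    (Finset.mul_prod_erase _ (fun l => if z l then 1 - δ else δ) (Finset.mem_univ i)).symm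
  have hf : f z = f (Function.update z i (z i)) := by simp
  rw [arrivalWeight_update, hw, hf]
  simp only [Function.update_idem]
  cases z i <;> simp <;> ring

lemma arrivalExpectation_ite (i : Fin n) (f : (Fin n → Bool) → ℝ) :
    arrivalExpectation δ (fun z => if z i then f z else 0) =
      (1 - δ) * arrivalExpectation δ (fun z => f (Function.update z i true)) := by
  rw [arrivalExpectation_cond i]
  simp [arrivalExpectation_const]

/-- The arrival indicator of player `i`, centered. -/
noncomputable def centeredArrival (δ : ℝ) (i : Fin n) (z : Fin n → Bool) : ℝ :=
  (if z i then 1 else 0) - (1 - δ)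

lemma arrivalExpectation_centeredArrival_mul (i : Fin n) (f : (Fin n → Bool) → ℝ) :
    arrivalExpectation δ (fun z => centeredArrival δ i z * f z) =
      (1 - δ) * δ * (arrivalExpectation δ (fun z => f (Function.update z i true)) -
        arrivalExpectation δ (fun z => f (Function.update z i false))) := by
  rw [arrivalExpectation_cond i]
  simp only [centeredArrival, Function.update_self, if_true, arrivalExpectation_const_mul,
    Bool.false_eq_true, if_false]
  ring

lemma arrivalExpectation_sq_sum_centeredArrival :
    arrivalExpectation δ (fun z : Fin n → Bool => (∑ i, centeredArrival δ i z) ^ 2) =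
      n * ((1 - δ) * δ) := by
  have hij : ∀ i l : Fin n, arrivalExpectation δ
      (fun z => centeredArrival δ i z * centeredArrival δ l z) =
        if i = l then (1 - δ) * δ else 0 := by
    intro i l
    rw [arrivalExpectation_centeredArrival_mul]
    split_ifs with h
    · subst h
      simp [centeredArrival, arrivalExpectation_const]
    · simp [centeredArrival, Function.update_of_ne (Ne.symm h)]
  simp only [sq, Finset.sum_mul_sum, arrivalExpectation_sum, hij]
  simp

/-- The total influence of the arrivals on a bounded function is of order at most `√n`: up to the
factor `δ` it is the covariance of the function with the number of arriving players, whose standard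
deviation is of that order. -/
lemma sum_influence_le (hδ0 : 0 < δ) (hδ1 : δ < 1) {B : ℝ} {f : (Fin n → Bool) → ℝ}
    (hf : ∀ z, 0 ≤ f z ∧ f z ≤ B) :
    ∑ i, arrivalExpectation δ (fun z => f z - f (Function.update z i false)) ≤
      B * Real.sqrt n / δ := by
  rcases Nat.eq_zero_or_pos n with rfl | hn
  · simp
  have hB : 0 ≤ B := (hf fun _ => true).1.trans (hf fun _ => true).2
  set t := Real.sqrt n with ht
  have ht0 : 0 < t := Real.sqrt_pos.2 (Nat.cast_pos.2 hn)
  have ht2 : t * t = n := Real.mul_self_sqrt (Nat.cast_nonneg n)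
  have h1 : ∀ i, δ * arrivalExpectation δ (fun z => f z - f (Function.update z i false)) =
      arrivalExpectation δ (fun z => centeredArrival δ i z * f z) := by
    intro i
    rw [arrivalExpectation_centeredArrival_mul, arrivalExpectation_sub, arrivalExpectation_cond i f]
    ring
  have h2 : ∀ z, ∑ i, centeredArrival δ i z * f z ≤
      B * ((∑ i, centeredArrival δ i z) ^ 2 * (1 / (2 * t)) + t / 2) := by
    intro z
    rw [← Finset.sum_mul]
    set S := ∑ i, centeredArrival δ i z
    have h3 : |S| ≤ S ^ 2 * (1 / (2 * t)) + t / 2 := by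
      have h4 : 0 ≤ (|S| - t) ^ 2 := sq_nonneg _
      have h5 : S ^ 2 * (1 / (2 * t)) + t / 2 - |S| = (|S| - t) ^ 2 / (2 * t) := by
        field_simp
        rw [sub_sq, sq_abs]
        ring
      have h6 : 0 ≤ (|S| - t) ^ 2 / (2 * t) := by positivity
      linarith
    calc S * f z ≤ |S| * f z := mul_le_mul_of_nonneg_right (le_abs_self S) (hf z).1
      _ ≤ |S| * B := mul_le_mul_of_nonneg_left (hf z).2 (abs_nonneg S)
      _ = B * |S| := mul_comm _ _
      _ ≤ _ := mul_le_mul_of_nonneg_left h3 hB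
  have h3 : δ * ∑ i, arrivalExpectation δ (fun z => f z - f (Function.update z i false)) ≤
      B * (n * ((1 - δ) * δ) * (1 / (2 * t)) + t / 2) := by
    rw [Finset.mul_sum, Finset.sum_congr rfl fun i _ => h1 i, ← arrivalExpectation_sum]
    refine (arrivalExpectation_mono hδ0.le hδ1.le h2).trans_eq ?_
    rw [arrivalExpectation_const_mul, arrivalExpectation_add, arrivalExpectation_const,
      ← arrivalExpectation_sq_sum_centeredArrival]
    simp only [mul_comm _ (1 / (2 * t)), arrivalExpectation_const_mul]
  rw [le_div_iff₀ hδ0, mul_comm]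
  refine h3.trans (mul_le_mul_of_nonneg_left ?_ hB)
  have h4 : (n : ℝ) * ((1 - δ) * δ) * (1 / (2 * t)) = t * ((1 - δ) * δ) / 2 := by
    rw [← ht2]
    field_simp
  rw [h4]
  nlinarith [sq_nonneg δ, sq_nonneg (1 - δ)]

end Arrivals

/-! ### Price impact of a deviation -/

section PriceImpact

variable {n m r : ℕ} {B δ : ℝ}

lemma arrivingBids_nonneg (b : Fin n → BidVector m r B) (z : Fin n → Bool) (j : Fin m) (i : Fin n)
    (x : Fin r) : 0 ≤ arrivingBids b z j i x := by
  unfold arrivingBids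
  split_ifs
  · exact ((b i).2 j).2 x |>.1
  · exact le_rfl

lemma arrivingBids_le (hB : 0 ≤ B) (b : Fin n → BidVector m r B) (z : Fin n → Bool) (j : Fin m)
    (i : Fin n) (x : Fin r) : arrivingBids b z j i x ≤ B := by
  unfold arrivingBids
  split_ifs
  · exact ((b i).2 j).2 x |>.2.le
  · exact hB

lemma arrivingBids_update_false (b : Fin n → BidVector m r B) (z : Fin n → Bool) (j : Fin m)
    (i : Fin n) :
    arrivingBids b (Function.update z i false) j = Function.update (arrivingBids b z j) i 0 := by
  funext l x
  by_cases h : l = i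
  · subst h; simp [arrivingBids]
  · simp [arrivingBids, h]

lemma arrivalExpectation_gap_le (hB : 0 ≤ B) (hδ0 : 0 < δ) (hδ1 : δ < 1)
    (b : Fin n → BidVector m r B) (j : Fin m) (a : ℕ) :
    arrivalExpectation δ (fun z => unitPrice a (arrivingBids b z j) -
      unitPrice (a + 1) (arrivingBids b z j)) ≤ r * (B * Real.sqrt n / δ) / (a + 1) := by
  rw [le_div_iff₀ (by positivity), mul_comm, ← arrivalExpectation_const_mul]
  refine (arrivalExpectation_mono hδ0.le hδ1.le fun z =>
    unitPrice_gap_le (arrivingBids_nonneg b z j) a).trans ?_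
  rw [arrivalExpectation_const_mul, arrivalExpectation_sum]
  gcongr
  simp only [← arrivingBids_update_false]
  exact sum_influence_le hδ0 hδ1 (f := fun z => unitPrice a (arrivingBids b z j)) fun z =>
    ⟨unitPrice_nonneg (arrivingBids_nonneg b z j) a, unitPrice_le hB (arrivingBids_le hB b z j) a⟩

/-- With random arrivals, moving the price by `r` ranks changes its expectation by `O(√n / k)`. -/
lemma arrivalExpectation_unitPrice_sub_le (hB : 0 ≤ B) (hδ0 : 0 < δ) (hδ1 : δ < 1)
    (b : Fin n → BidVector m r B) (j : Fin m) {k : ℕ} (hk : r ≤ k) :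
    arrivalExpectation δ (fun z => unitPrice (k - r) (arrivingBids b z j)) ≤
      arrivalExpectation δ (fun z => unitPrice k (arrivingBids b z j)) +
        r * (r * (B * Real.sqrt n / δ) / ((k : ℝ) - r + 1)) := by
  obtain ⟨a, rfl⟩ := Nat.exists_eq_add_of_le' hk
  rw [Nat.add_sub_cancel, ← sub_le_iff_le_add', ← arrivalExpectation_sub]
  have htel : ∀ z, unitPrice a (arrivingBids b z j) - unitPrice (a + r) (arrivingBids b z j) =
      ∑ t ∈ Finset.range r, (unitPrice (a + t) (arrivingBids b z j) -
        unitPrice (a + t + 1) (arrivingBids b z j)) := fun z =>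
    (Finset.sum_range_sub' (fun t => unitPrice (a + t) (arrivingBids b z j)) r).symm
  simp only [htel, arrivalExpectation_sum]
  refine (Finset.sum_le_card_nsmul _ _ (r * (B * Real.sqrt n / δ) / ((a : ℝ) + 1))
    fun t _ => ?_).trans_eq ?_
  · refine (arrivalExpectation_gap_le hB hδ0 hδ1 b j (a + t)).trans ?_
    push_cast
    have : (0 : ℝ) ≤ t := Nat.cast_nonneg t
    gcongr
    linarith
  · simp

end PriceImpact

/-! ### A deterministic allocation that is nearly optimal and nearly feasible on average -/

/-- Derandomization: independent random vectors `W i`, centered for the weights `w`, of squared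
length at most `D` take, for some outcomes, values whose sum has squared length at most `n * D`. -/
lemma exists_choice_sum_sq_le {Z T : Type*} [Fintype Z] [Nonempty Z] [Fintype T] {w : Z → ℝ}
    (hw : ∀ z, 0 < w z) {D : ℝ} {n : ℕ} (W : Fin n → Z → T → ℝ)
    (h0 : ∀ i t, ∑ z, w z * W i z t = 0) (hD : ∀ i z, ∑ t, W i z t ^ 2 ≤ D) :
    ∃ ζ : Fin n → Z, ∑ t, (∑ i, W i (ζ i) t) ^ 2 ≤ n * D := by
  induction n with
  | zero => exact ⟨Fin.elim0, by simp⟩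
  | succ n ih =>
    obtain ⟨ζ, hζ⟩ := ih (fun i => W i.succ) (fun i => h0 i.succ) (fun i => hD i.succ)
    set S : T → ℝ := fun t => ∑ i, W i.succ (ζ i) t with hS
    have havg : ∑ z, w z * ∑ t, (W 0 z t + S t) ^ 2 ≤ ∑ z, w z * (D + ∑ t, S t ^ 2) := by
      have h1 : ∀ z, w z * ∑ t, (W 0 z t + S t) ^ 2 =
          w z * ∑ t, W 0 z t ^ 2 + ∑ t, 2 * S t * (w z * W 0 z t) + w z * ∑ t, S t ^ 2 := by
        intro z
        simp only [Finset.mul_sum, ← Finset.sum_add_distrib]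
        exact Finset.sum_congr rfl fun t _ => by ring
      have h2 : ∑ z, ∑ t, 2 * S t * (w z * W 0 z t) = 0 := by
        rw [Finset.sum_comm]
        exact Finset.sum_eq_zero fun t _ => by rw [← Finset.mul_sum, h0, mul_zero]
      simp only [h1, Finset.sum_add_distrib, h2, add_zero, mul_add]
      gcongr with z
      · exact (hw z).le
      · exact hD 0 z
    obtain ⟨z, -, hz⟩ := Finset.exists_le_of_sum_le Finset.univ_nonempty havg
    refine ⟨Fin.cons z ζ, ?_⟩
    simp only [Fin.sum_univ_succ, Fin.cons_zero, Fin.cons_succ]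
    have := le_of_mul_le_mul_left hz (hw z)
    push_cast
    linarith

section Allocation

variable {n m r : ℕ} {ρ H δ : ℝ}

lemma bddAbove_welfare (k : Fin m → ℕ) (v : Fin n → BundleValuation m r ρ H) (z : Fin n → Bool) :
    BddAbove (Set.range fun x : {x : Fin n → Fin m → ℕ // ∀ j, ∑ i, x i j ≤ k j} =>
      ∑ i, if z i then (v i).1 (x.1 i) else 0) := by
  refine ⟨∑ _ : Fin n, |H|, ?_⟩
  rintro _ ⟨x, rfl⟩
  refine Finset.sum_le_sum fun i _ => ?_
  split_ifs
  · exact ((v i).2.1 _).2.trans (le_abs_self H)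
  · exact abs_nonneg H

lemma le_optimalWelfare (k : Fin m → ℕ) (v : Fin n → BundleValuation m r ρ H) (z : Fin n → Bool)
    {x : Fin n → Fin m → ℕ} (hx : ∀ j, ∑ i, x i j ≤ k j) :
    ∑ i, (if z i then (v i).1 (x i) else 0) ≤ optimalWelfare k v z :=
  le_ciSup (bddAbove_welfare k v z) ⟨x, hx⟩

lemma optimalWelfare_le (hH : 0 ≤ H) (k : Fin m → ℕ) (v : Fin n → BundleValuation m r ρ H)
    (z : Fin n → Bool) : optimalWelfare k v z ≤ n * H := by
  have : Nonempty {x : Fin n → Fin m → ℕ // ∀ j, ∑ i, x i j ≤ k j} := ⟨⟨0, by simp⟩⟩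
  refine ciSup_le fun x => (Finset.sum_le_card_nsmul _ _ H fun i _ => ?_).trans_eq (by simp)
  split_ifs
  · exact ((v i).2.1 _).2
  · exact hH

lemma optimalWelfare_nonneg (k : Fin m → ℕ) (v : Fin n → BundleValuation m r ρ H)
    (z : Fin n → Bool) : 0 ≤ optimalWelfare k v z := by
  refine le_trans ?_ (le_optimalWelfare k v z (x := 0) (by simp))
  refine Finset.sum_nonneg fun i _ => ?_
  split_ifs
  · exact ((v i).2.1 _).1
  · exact le_rfl

/-- The allocation comes from sampling, for each player independently, fresh arrivals of the other
players, and giving him his bundle of an optimal allocation for these arrivals. On average this has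
optimal welfare and respects the supplies; derandomization costs an error of order `√n`. -/
lemma exists_deterministic_allocation (hδ0 : 0 < δ) (hδ1 : δ < 1) (k : Fin m → ℕ)
    (v : Fin n → BundleValuation m r ρ H) :
    ∃ d : Fin n → Fin m → ℕ, (∀ i j, d i j ≤ r) ∧
      arrivalExpectation δ (fun z => optimalWelfare k v z) ≤
        (1 - δ) * ∑ i, (v i).1 (d i) + 1 + Real.sqrt (n * (H ^ 2 + m * r ^ 2)) ∧
      ∀ j, (1 - δ) * ∑ i, (d i j : ℝ) ≤ k j + Real.sqrt (n * (H ^ 2 + m * r ^ 2)) := by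
  have hopt : ∀ z, ∃ x : Fin n → Fin m → ℕ, (∀ j, ∑ i, x i j ≤ k j) ∧
      optimalWelfare k v z - 1 ≤ ∑ i, if z i then (v i).1 (x i) else 0 := fun z => by
    have : Nonempty {x : Fin n → Fin m → ℕ // ∀ j, ∑ i, x i j ≤ k j} := ⟨⟨0, by simp⟩⟩
    obtain ⟨x, hx⟩ := exists_lt_of_lt_ciSup (sub_one_lt (optimalWelfare k v z))
    exact ⟨x.1, x.2, hx.le⟩
  choose x hxk hxopt using hopt
  -- the sampled bundle of player `i`, and its value and size as one vector of real numbers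
  let X : Fin n → (Fin n → Bool) → Fin m → ℕ :=
    fun i z j => min (x (Function.update z i true) i j) r
  let F : Fin n → (Fin n → Bool) → Option (Fin m) → ℝ :=
    fun i z t => t.elim ((v i).1 (X i z)) fun j => X i z j
  let M : Option (Fin m) → ℝ := fun t => t.elim H fun _ => r
  have hF : ∀ i z t, 0 ≤ F i z t ∧ F i z t ≤ M t := by
    rintro i z (_ | j)
    · exact (v i).2.1 _
    · exact ⟨Nat.cast_nonneg _, Nat.cast_le.2 (min_le_right _ _)⟩
  set D := H ^ 2 + (m : ℝ) * r ^ 2 with hDdef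
  obtain ⟨ζ, hζ⟩ := exists_choice_sum_sq_le (T := Option (Fin m)) (D := D)
    (w := fun z : Fin n → Bool => ∏ i, if z i then 1 - δ else δ)
    (fun z => Finset.prod_pos fun i _ => by split_ifs <;> linarith)
    (fun i z t => F i z t - arrivalExpectation δ fun z => F i z t)
    (fun i t => by
      have h : arrivalExpectation δ
          (fun z => F i z t - arrivalExpectation δ fun z => F i z t) = 0 := by
        rw [arrivalExpectation_sub, arrivalExpectation_const, sub_self]
      exact h)
    (fun i z => by
      have hDM : D = ∑ t, M t ^ 2 := by simp [Fintype.sum_option, M, D]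
      rw [hDM]
      refine Finset.sum_le_sum fun t _ => ?_
      have h1 : 0 ≤ arrivalExpectation δ fun z => F i z t := by
        have := arrivalExpectation_mono hδ0.le hδ1.le fun z => (hF i z t).1
        rwa [arrivalExpectation_const] at this
      have h2 : (arrivalExpectation δ fun z => F i z t) ≤ M t := by
        have := arrivalExpectation_mono hδ0.le hδ1.le fun z => (hF i z t).2
        rwa [arrivalExpectation_const] at this
      exact sq_le_sq' (by linarith [(hF i z t).1]) (by linarith [(hF i z t).2]))
  have hdev : ∀ t, |∑ i, F i (ζ i) t - ∑ i, arrivalExpectation δ fun z => F i z t| ≤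
      Real.sqrt (n * D) := fun t => by
    rw [← Finset.sum_sub_distrib]
    exact Real.abs_le_sqrt ((Finset.single_le_sum (f := fun t => (∑ i, (F i (ζ i) t -
      arrivalExpectation δ fun z => F i z t)) ^ 2) (fun _ _ => sq_nonneg _)
      (Finset.mem_univ t)).trans hζ)
  have hscale : ∀ a : ℝ, 0 ≤ a → (1 - δ) * a ≤ a := fun a ha => by nlinarith
  refine ⟨fun i => X i (ζ i), fun i j => min_le_right _ _, ?_, fun j => ?_⟩
  · have h1 : (1 - δ) * ∑ i, (arrivalExpectation δ fun z => F i z none) =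
        arrivalExpectation δ fun z => ∑ i, if z i then (v i).1 (x z i) else 0 := by
      rw [arrivalExpectation_sum, Finset.mul_sum]
      refine Finset.sum_congr rfl fun i _ => ?_
      rw [arrivalExpectation_ite]
      congr 2
      funext z
      exact ((v i).2.2.1 _).symm
    have h2 := arrivalExpectation_mono hδ0.le hδ1.le hxopt
    rw [arrivalExpectation_sub, arrivalExpectation_const, ← h1] at h2
    have h3 := (abs_le.1 (hdev none)).1
    have h4 := hscale _ (Real.sqrt_nonneg (n * D))
    have h5 : (1 - δ) * (-Real.sqrt (n * D)) ≤ (1 - δ) * _ :=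
      mul_le_mul_of_nonneg_left h3 (by linarith)
    have h6 : ∑ i, F i (ζ i) none = ∑ i, (v i).1 (X i (ζ i)) := rfl
    rw [← h6]
    linarith
  · have h1 : (1 - δ) * ∑ i, (arrivalExpectation δ fun z => F i z (some j)) ≤ k j := by
      have h2 : (1 - δ) * ∑ i, (arrivalExpectation δ fun z => F i z (some j)) =
          arrivalExpectation δ fun z => ∑ i, if z i then ((min (x z i j) r : ℕ) : ℝ) else 0 := by
        rw [arrivalExpectation_sum, Finset.mul_sum]
        exact Finset.sum_congr rfl fun i _ => (arrivalExpectation_ite i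
          fun z => ((min (x z i j) r : ℕ) : ℝ)).symm
      rw [h2, ← arrivalExpectation_const (n := n) (δ := δ) (k j : ℝ)]
      refine arrivalExpectation_mono hδ0.le hδ1.le fun z => ?_
      have h3 : ∑ i, (x z i j : ℝ) ≤ k j := by exact_mod_cast hxk z j
      refine (Finset.sum_le_sum fun i _ => ?_).trans h3
      split_ifs
      · exact Nat.cast_le.2 (min_le_left _ _)
      · exact Nat.cast_nonneg _
    have h3 := (abs_le.1 (hdev (some j))).2
    have h4 := hscale _ (Real.sqrt_nonneg (n * D))
    have h5 : (1 - δ) * _ ≤ (1 - δ) * Real.sqrt (n * D) :=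
      mul_le_mul_of_nonneg_left h3 (by linarith)
    have h6 : ∑ i, F i (ζ i) (some j) = ∑ i, (X i (ζ i) j : ℝ) := rfl
    rw [← h6]
    linarith

/-- One unit of a single good for each player shows that the optimal welfare is linear in `n`. -/
lemma linear_le_optimum (hρ : 0 ≤ ρ) (hδ0 : 0 ≤ δ) (hδ1 : δ ≤ 1) {k : Fin m → ℕ}
    {j₀ : Fin m} {c : ℝ} (hk : c * n ≤ k j₀) (v : Fin n → BundleValuation m r ρ H) :
    (1 - δ) * (ρ * min c 1) * n ≤ arrivalExpectation δ fun z => optimalWelfare k v z := by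
  classical
  let e : Fin m → ℕ := Pi.single j₀ 1
  let x : Fin n → Fin m → ℕ := fun i => if (i : ℕ) < k j₀ then e else 0
  have hcard : (Finset.univ.filter fun i : Fin n => (i : ℕ) < k j₀).card = min n (k j₀) :=
    Fin.card_filter_val_lt
  have hx : ∀ j, ∑ i, x i j ≤ k j := by
    intro j
    by_cases hj : j = j₀
    · subst hj
      have : ∀ i, x i j = if (i : ℕ) < k j then 1 else 0 := fun i => by
        simp only [x]; split_ifs <;> simp [e]
      simp only [this]
      rw [← Finset.card_filter, hcard]
      exact min_le_right _ _
    · have : ∀ i, x i j = 0 := fun i => by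
        simp only [x]; split_ifs <;> simp [e, hj]
      simp [this]
  refine le_trans ?_ (arrivalExpectation_mono hδ0 hδ1 fun z => le_optimalWelfare k v z hx)
  rw [arrivalExpectation_sum]
  simp only [arrivalExpectation_ite, arrivalExpectation_const]
  rw [← Finset.mul_sum, mul_assoc]
  refine mul_le_mul_of_nonneg_left ?_ (by linarith)
  have h1 : ∀ i : Fin n, (if (i : ℕ) < k j₀ then ρ else 0) ≤ (v i).1 (x i) := by
    intro i
    split_ifs with h
    · refine (v i).2.2.2 _ fun h0 => ?_
      have := congrFun h0 j₀
      simp [x, h, e] at this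
    · exact ((v i).2.1 _).1
  refine le_trans ?_ (Finset.sum_le_sum fun i _ => h1 i)
  rw [← Finset.sum_filter, Finset.sum_const, hcard, nsmul_eq_mul, mul_comm _ ρ, mul_assoc]
  refine mul_le_mul_of_nonneg_left ?_ hρ
  have hn : (0 : ℝ) ≤ n := Nat.cast_nonneg n
  rw [Nat.cast_min]
  exact le_min ((mul_le_mul_of_nonneg_right (min_le_right c 1) hn).trans_eq (one_mul _))
    ((mul_le_mul_of_nonneg_right (min_le_left c 1) hn).trans hk)

end Allocation

/-! ### Smoothness of the auction -/

section Smoothness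

variable {n m r : ℕ} {ρ H B δ : ℝ}

lemma orderExpectation_mono {f g : (Fin m → Equiv.Perm (Fin n)) → ℝ} (h : ∀ π, f π ≤ g π) :
    orderExpectation f ≤ orderExpectation g :=
  div_le_div_of_nonneg_right (Finset.sum_le_sum fun π _ => h π) (Nat.cast_nonneg _)

lemma orderExpectation_const (c : ℝ) :
    orderExpectation (fun _ : Fin m → Equiv.Perm (Fin n) => c) = c := by
  rw [orderExpectation, Finset.sum_const, nsmul_eq_mul, Finset.card_univ, mul_comm]
  exact mul_div_cancel_right₀ c (Nat.cast_ne_zero.2 Fintype.card_ne_zero)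

lemma orderExpectation_sum {ι : Type*} (s : Finset ι)
    (f : ι → (Fin m → Equiv.Perm (Fin n)) → ℝ) :
    orderExpectation (fun π => ∑ i ∈ s, f i π) = ∑ i ∈ s, orderExpectation (f i) := by
  simp only [orderExpectation]
  rw [Finset.sum_comm, Finset.sum_div]

lemma orderExpectation_add (f g : (Fin m → Equiv.Perm (Fin n)) → ℝ) :
    orderExpectation (fun π => f π + g π) = orderExpectation f + orderExpectation g := by
  simp only [orderExpectation, Finset.sum_add_distrib, add_div]

/-- The strategy of bidding `b` on `d j` units of each good `j`. -/
def flatBid (d : Fin m → ℕ) (b : ℝ) (hb : 0 ≤ b ∧ b < B) : BidVector m r B :=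
  ⟨fun j x => if (x : ℕ) < d j then b else 0, fun j => by
    refine ⟨fun x y hxy => ?_, fun x => ?_⟩
    · have : (x : ℕ) ≤ y := hxy
      dsimp only
      split_ifs with h1 h2
      · exact le_rfl
      · omega
      · exact hb.1
      · exact le_rfl
    · dsimp only
      split_ifs
      · exact hb
      · exact ⟨le_rfl, hb.1.trans_lt hb.2⟩⟩

/-- A flat bid that is `η`-close to the largest possible value secures, for all bids of the others,
the utility of buying the desired bundle at the resulting prices, up to `η`: if some unit is lost,
its price already exhausts the value of the bundle. -/
lemma flatBid_utility_ge {k : Fin m → ℕ} {s : Fin n → BidVector m r B} {z : Fin n → Bool}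
    {π : Fin m → Equiv.Perm (Fin n)} {i : Fin n} (hz : z i = true) {d : Fin m → ℕ}
    (hd : ∀ j, d j ≤ r) {b η : ℝ} (hb0 : 0 < b) (hbB : b < B) (hη : 0 ≤ η) (hHb : H ≤ b + η)
    (hs : s i = flatBid d b ⟨hb0.le, hbB⟩) (vi : BundleValuation m r ρ H) :
    vi.1 d - η - ∑ j, (d j : ℝ) * unitPrice (k j) (arrivingBids s z j) ≤
      vi.1 (bundleWon k s z π i) - payment k s z π i := by
  have hrow : ∀ j (x : Fin r), arrivingBids s z j i x = if (x : ℕ) < d j then b else 0 := by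
    intro j x
    simp [arrivingBids, hz, hs, flatBid]
  have hstep : ∀ j, bundleWon k s z π i j ≤ d j ∧
      (bundleWon k s z π i j < d j → b ≤ unitPrice (k j) (arrivingBids s z j)) := fun j =>
    unitsWon_of_flat_row (hd j) hb0 (hrow j) (k j) (π j)
  have hprice : ∀ j, 0 ≤ unitPrice (k j) (arrivingBids s z j) := fun j =>
    unitPrice_nonneg (arrivingBids_nonneg s z j) _
  unfold payment
  by_cases hall : ∀ j, bundleWon k s z π i j = d j
  · have : bundleWon k s z π i = d := funext hall
    rw [this]
    linarith
  · push Not at hall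
    obtain ⟨j, hj⟩ := hall
    have hlt := lt_of_le_of_ne (hstep j).1 hj
    have hcast : ∀ l, (bundleWon k s z π i l : ℝ) ≤ d l := fun l => Nat.cast_le.2 (hstep l).1
    have hsum : b ≤ ∑ l, ((d l : ℝ) - bundleWon k s z π i l) *
        unitPrice (k l) (arrivingBids s z l) := by
      refine le_trans ?_ (Finset.single_le_sum (fun l _ => mul_nonneg
        (sub_nonneg.2 (hcast l)) (hprice l)) (Finset.mem_univ j))
      have h1 : (1 : ℝ) ≤ (d j : ℝ) - bundleWon k s z π i j := by
        have : ((bundleWon k s z π i j + 1 : ℕ) : ℝ) ≤ d j := Nat.cast_le.2 hlt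
        push_cast at this
        linarith
      exact ((hstep j).2 hlt).trans (le_mul_of_one_le_left (hprice j) h1)
    simp only [sub_mul, Finset.sum_sub_distrib] at hsum
    linarith [(vi.2.1 d).2, (vi.2.1 (bundleWon k s z π i)).1]

/-- The revenue from each good is at least the price times the supply. -/
lemma sum_mul_unitPrice_le_revenue (hδ0 : 0 ≤ δ) (hδ1 : δ ≤ 1) (k : Fin m → ℕ)
    (s : Fin n → BidVector m r B) :
    ∑ j, (k j : ℝ) * arrivalExpectation δ (fun z => unitPrice (k j) (arrivingBids s z j)) ≤
      (noisyUniformPriceAuction n m r ρ H B δ k).revenue s := by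
  simp only [← arrivalExpectation_const_mul, ← arrivalExpectation_sum]
  refine arrivalExpectation_mono hδ0 hδ1 fun z => ?_
  rw [← orderExpectation_const (n := n) (m := m)
    (∑ j, (k j : ℝ) * unitPrice (k j) (arrivingBids s z j))]
  refine orderExpectation_mono fun π => ?_
  simp only [payment]
  rw [Finset.sum_comm]
  exact Finset.sum_le_sum fun j _ => mul_unitPrice_le_sum (arrivingBids_nonneg s z j) (k j) (π j)

/-- Expected utility of a flat bid. The price that the player faces is bounded by an order statistic
of the bids of the others, which does not depend on his own arrival. -/
lemma flatBid_expected_utility_ge (hB : 0 ≤ B) (hδ0 : 0 < δ) (hδ1 : δ < 1) {k : Fin m → ℕ}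
    (hk : ∀ j, r ≤ k j) (s : Fin n → BidVector m r B) (i : Fin n) {d : Fin m → ℕ}
    (hd : ∀ j, d j ≤ r) {b η : ℝ} (hb0 : 0 < b) (hbB : b < B) (hη : 0 ≤ η) (hHb : H ≤ b + η)
    (vi : BundleValuation m r ρ H) :
    (1 - δ) * (vi.1 d - η - ∑ j, (d j : ℝ) * (arrivalExpectation δ
      (fun z => unitPrice (k j) (arrivingBids s z j)) +
        r * (r * (B * Real.sqrt n / δ) / ((k j : ℝ) - r + 1)))) ≤
    (noisyUniformPriceAuction n m r ρ H B δ k).utility i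
      (Function.update s i (flatBid d b ⟨hb0.le, hbB⟩)) vi := by
  set s' := Function.update s i (flatBid d b ⟨hb0.le, hbB⟩) with hs'
  have hpt : ∀ z, (if z i then vi.1 d - η - ∑ j, (d j : ℝ) * unitPrice (k j - r)
      (arrivingBids s (Function.update z i false) j) else 0) ≤
      orderExpectation fun π => if z i then vi.1 (bundleWon k s' z π i) - payment k s' z π i
        else 0 := by
    intro z
    split_ifs with hz
    · rw [← orderExpectation_const (n := n) (m := m) (vi.1 d - η - _)]
      refine orderExpectation_mono fun π => le_trans ?_
        (flatBid_utility_ge hz hd hb0 hbB hη hHb (Function.update_self i _ s) vi)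
      gcongr with j
      refine unitPrice_le_of_eq_off (i := i) (arrivingBids_nonneg _ _ _) (fun l hl => ?_) (hk j)
      funext x
      simp [arrivingBids, hl]
    · rw [orderExpectation_const]
  refine le_trans ?_ (arrivalExpectation_mono hδ0.le hδ1.le hpt)
  rw [arrivalExpectation_ite]
  simp only [Function.update_idem]
  refine mul_le_mul_of_nonneg_left ?_ (by linarith)
  rw [arrivalExpectation_sub, arrivalExpectation_const, arrivalExpectation_sum]
  simp only [arrivalExpectation_const_mul]
  gcongr with j
  refine le_trans (arrivalExpectation_mono hδ0.le hδ1.le fun z => ?_)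
    (arrivalExpectation_unitPrice_sub_le hB hδ0 hδ1 s j (hk j))
  rw [arrivingBids_update_false]
  exact unitPrice_mono (arrivingBids_nonneg _ _ _)
    (fun l x => (update_zero_bounds (arrivingBids_nonneg s z j) i l x).2) _

/-- The additive error of smoothness, relative to `√n`. -/
noncomputable def smoothnessError (m r : ℕ) (H B δ c : ℝ) : ℝ :=
  1 + B + Real.sqrt (H ^ 2 + m * r ^ 2) +
    m * (Real.sqrt (H ^ 2 + m * r ^ 2) * B + 2 * r ^ 3 * B / (δ * c))

/-- The auction is `(1, 1)`-smooth up to an additive error of order `√n`, with deviations that do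
not depend on the strategies of the others. -/
lemma exists_smooth_deviation (hB : 0 < B) (hHB : H ≤ B) (hδ0 : 0 < δ) (hδ1 : δ < 1) {c : ℝ}
    (hc : 0 < c) (hn : 0 < n) {k : Fin m → ℕ} (hk : ∀ j, r ≤ k j)
    (hkc : ∀ j, c * n / 2 ≤ (k j : ℝ) - r + 1) (v : Fin n → BundleValuation m r ρ H) :
    ∃ sStar : Fin n → BidVector m r B, ∀ s : Fin n → BidVector m r B,
      (noisyUniformPriceAuction n m r ρ H B δ k).optimum v -
          (noisyUniformPriceAuction n m r ρ H B δ k).revenue s -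
          smoothnessError m r H B δ c * Real.sqrt n ≤
        ∑ i, (noisyUniformPriceAuction n m r ρ H B δ k).utility i
          (Function.update s i (sStar i)) (v i) := by
  obtain ⟨d, hdr, hdopt, hdk⟩ := exists_deterministic_allocation hδ0 hδ1 k v
  have hn0 : (0 : ℝ) < n := Nat.cast_pos.2 hn
  have hn1 : (1 : ℝ) ≤ n := Nat.one_le_cast.2 hn
  -- the flat bid `B * n / (n + 1)` is within `B / (n + 1)` of `B`
  set b : ℝ := B * n / (n + 1) with hb
  set η : ℝ := B / (n + 1) with hη
  have hbη : b + η = B := by rw [hb, hη]; field_simp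
  have hη0 : 0 < η := by positivity
  have hb0 : 0 < b := by positivity
  have hbB : b < B := by linarith
  have hnη : n * η ≤ B := by
    have : n * η = b := by rw [hb, hη]; ring
    linarith
  refine ⟨fun i => flatBid (d i) b ⟨hb0.le, hbB⟩, fun s => ?_⟩
  set P : Fin m → ℝ := fun j => arrivalExpectation δ fun z => unitPrice (k j) (arrivingBids s z j)
    with hP
  set κ : Fin m → ℝ := fun j => r * (r * (B * Real.sqrt n / δ) / ((k j : ℝ) - r + 1)) with hκ
  set D := H ^ 2 + (m : ℝ) * r ^ 2 with hD
  have hD0 : 0 ≤ D := by positivity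
  have hP0 : ∀ j, 0 ≤ P j := fun j => by
    have := arrivalExpectation_mono hδ0.le hδ1.le fun z =>
      unitPrice_nonneg (arrivingBids_nonneg s z j) (k j)
    rwa [arrivalExpectation_const] at this
  have hPB : ∀ j, P j ≤ B := fun j => by
    have := arrivalExpectation_mono hδ0.le hδ1.le fun z =>
      unitPrice_le hB.le (arrivingBids_le hB.le s z j) (k j)
    rwa [arrivalExpectation_const] at this
  have hsqrt : Real.sqrt (n * D) = Real.sqrt D * Real.sqrt n := by
    rw [Real.sqrt_mul hn0.le, mul_comm]
  have hsqrt1 : 1 ≤ Real.sqrt n := by rwa [Real.one_le_sqrt]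
  have hκ0 : ∀ j, 0 ≤ κ j := fun j => by
    have := (by positivity : 0 ≤ c * n / 2).trans (hkc j)
    positivity
  have hnκ : ∀ j, n * r * κ j ≤ 2 * r ^ 3 * B / (δ * c) * Real.sqrt n := fun j => by
    calc n * r * κ j
        ≤ n * r * (r * (r * (B * Real.sqrt n / δ) / (c * n / 2))) := by
          simp only [hκ]
          have := hkc j
          gcongr
      _ = 2 * r ^ 3 * B / (δ * c) * Real.sqrt n := by
          field_simp
  -- the expected demand for good `j` is at most the supply, up to `√n`, and at most `n * r`
  have hpay : ∀ j, (1 - δ) * (∑ i, (d i j : ℝ)) * (P j + κ j) ≤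
      k j * P j + (Real.sqrt D * B + 2 * r ^ 3 * B / (δ * c)) * Real.sqrt n := by
    intro j
    have h1 : (1 - δ) * (∑ i, (d i j : ℝ)) ≤ n * r := by
      have h2 : ∑ i, (d i j : ℝ) ≤ n * r := by
        refine (Finset.sum_le_card_nsmul _ _ (r : ℝ) fun i _ => Nat.cast_le.2 (hdr i j)).trans_eq ?_
        simp
      have h3 : 0 ≤ ∑ i, (d i j : ℝ) := Finset.sum_nonneg fun i _ => Nat.cast_nonneg _
      nlinarith
    have h2 : (1 - δ) * (∑ i, (d i j : ℝ)) * P j ≤ k j * P j + Real.sqrt D * B * Real.sqrt n := by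
      calc _ ≤ (k j + Real.sqrt (n * D)) * P j := mul_le_mul_of_nonneg_right (hdk j) (hP0 j)
        _ = k j * P j + Real.sqrt (n * D) * P j := add_mul _ _ _
        _ ≤ k j * P j + Real.sqrt (n * D) * B := by
            gcongr
            exact hPB j
        _ = _ := by rw [hsqrt]; ring
    have h3 := (mul_le_mul_of_nonneg_right h1 (hκ0 j)).trans (hnκ j)
    rw [mul_add, add_mul (Real.sqrt D * B)]
    linarith
  have hrev := sum_mul_unitPrice_le_revenue (ρ := ρ) (H := H) hδ0.le hδ1.le k s
  have hutil := Finset.sum_le_sum fun (i : Fin n) (_ : i ∈ Finset.univ) =>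
    flatBid_expected_utility_ge hB.le hδ0 hδ1 hk s i (hdr i) hb0 hbB hη0.le (hHB.trans hbη.ge) (v i)
  refine le_trans ?_ hutil
  have hexpand : ∑ i, (1 - δ) * ((v i).1 (d i) - η - ∑ j, (d i j : ℝ) * (P j + κ j)) =
      (1 - δ) * ∑ i, (v i).1 (d i) - (1 - δ) * (n * η) -
        ∑ j, (1 - δ) * (∑ i, (d i j : ℝ)) * (P j + κ j) := by
    rw [← Finset.mul_sum, Finset.sum_sub_distrib, Finset.sum_sub_distrib, Finset.sum_comm]
    simp only [← Finset.sum_mul, mul_assoc, ← Finset.mul_sum]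
    simp
    ring
  have hsum := Finset.sum_le_sum fun (j : Fin m) (_ : j ∈ Finset.univ) => hpay j
  rw [Finset.sum_add_distrib, Finset.sum_const, nsmul_eq_mul, Finset.card_univ,
    Fintype.card_fin] at hsum
  rw [hexpand]
  have hopt : (noisyUniformPriceAuction n m r ρ H B δ k).optimum v ≤
      (1 - δ) * ∑ i, (v i).1 (d i) + 1 + Real.sqrt D * Real.sqrt n := hsqrt ▸ hdopt
  have hη1 : (1 - δ) * (n * η) ≤ B := by
    have : 0 ≤ n * η := by positivity
    nlinarith
  have herr : smoothnessError m r H B δ c * Real.sqrt n =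
      Real.sqrt n + B * Real.sqrt n + Real.sqrt D * Real.sqrt n +
        m * ((Real.sqrt D * B + 2 * r ^ 3 * B / (δ * c)) * Real.sqrt n) := by
    rw [smoothnessError]; ring
  have hBn : B ≤ B * Real.sqrt n := le_mul_of_one_le_right hB.le hsqrt1
  linarith

end Smoothness

/-! ### From smoothness to Bayes-Nash equilibria -/

section Extension

variable {n : ℕ} {S V : Type} [MeasurableSpace S] [MeasurableSpace V]

/-- Resampling one coordinate of a random vector with independent coordinates does not change its
law. -/
lemma measurePreserving_pi_update {X : Type*} [MeasurableSpace X] (μ : Fin n → Measure X)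
    [∀ i, IsProbabilityMeasure (μ i)] (i : Fin n) :
    MeasurePreserving (fun p : (Fin n → X) × X => Function.update p.1 i p.2)
      ((Measure.pi μ).prod (μ i)) (Measure.pi μ) := by
  have hmeas : Measurable fun p : (Fin n → X) × X => Function.update p.1 i p.2 := by
    refine measurable_pi_lambda _ fun j => ?_
    by_cases h : j = i
    · subst h
      simpa using measurable_snd
    · simpa [h, Function.comp_def] using (measurable_pi_apply j).comp measurable_fst
  refine ⟨hmeas, (Measure.pi_eq fun s hs => ?_).symm⟩
  rw [Measure.map_apply hmeas (MeasurableSet.univ_pi hs)]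
  have hpre : (fun p : (Fin n → X) × X => Function.update p.1 i p.2) ⁻¹' (Set.univ.pi s) =
      (Set.univ.pi (Function.update s i Set.univ)) ×ˢ s i := by
    ext p
    simp only [Set.mem_preimage, Set.mem_univ_pi, Set.mem_prod]
    constructor
    · intro h
      refine ⟨fun j => ?_, by simpa using h i⟩
      by_cases hj : j = i
      · subst hj; simp
      · simpa [hj] using h j
    · rintro ⟨h, hi⟩ j
      by_cases hj : j = i
      · subst hj; simpa using hi
      · simpa [hj] using h j
  rw [hpre, Measure.prod_prod, Measure.pi_pi, mul_comm,
    ← Finset.mul_prod_erase _ _ (Finset.mem_univ i),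
    ← Finset.mul_prod_erase _ _ (Finset.mem_univ i)]
  simp only [Function.update_self, measure_univ, one_mul]
  congr 1
  exact Finset.prod_congr rfl fun j hj => by
    rw [Function.update_of_ne (Finset.ne_of_mem_erase hj)]

/-- Integrated over the own valuation, the equilibrium utility of a player against fresh copies of
the others is his expected utility in the play of the equilibrium. -/
lemma integral_equilibrium_utility (u : (Fin n → S) → V → ℝ)
    (hu : Measurable fun p : (Fin n → S) × V => u p.1 p.2) {K : ℝ} (hK : ∀ s v, |u s v| ≤ K)
    (F : Fin n → Measure V) (σ : Fin n → Kernel V S) [∀ i, IsProbabilityMeasure (F i)]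
    [∀ i, IsMarkovKernel (σ i)] (i : Fin n) :
    Integrable (fun vi => ∫ ω, (∫ s, u (Function.update (fun j => (ω j).2) i s) vi ∂(σ i vi))
      ∂(playLaw F σ)) (F i) ∧
    ∫ vi, (∫ ω, (∫ s, u (Function.update (fun j => (ω j).2) i s) vi ∂(σ i vi)) ∂(playLaw F σ))
      ∂(F i) = ∫ ω, u (fun j => (ω j).2) (ω i).1 ∂(playLaw F σ) := by
  have : IsProbabilityMeasure (playLaw F σ) := by unfold playLaw; infer_instance
  set μ := playLaw F σ with hμ
  have hupd : Measurable fun p : (Fin n → V × S) × S =>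
      Function.update (fun j => (p.1 j).2) i p.2 := by
    refine measurable_pi_lambda _ fun j => ?_
    by_cases h : j = i
    · subst h
      simpa using measurable_snd
    · simpa [h, Function.comp_def] using
        measurable_snd.comp ((measurable_pi_apply j).comp measurable_fst)
  let g : (Fin n → V × S) × (V × S) → ℝ :=
    fun p => u (Function.update (fun j => (p.1 j).2) i p.2.2) p.2.1
  have hg : Measurable g :=
    hu.comp ((hupd.comp (measurable_fst.prodMk (measurable_snd.comp measurable_snd))).prodMk
      (measurable_fst.comp measurable_snd))
  have hgK : ∀ p, ‖g p‖ ≤ K := fun p => hK _ _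
  have hgint : Integrable g (μ.prod (F i ⊗ₘ σ i)) :=
    Integrable.of_bound hg.aestronglyMeasurable K (ae_of_all _ hgK)
  have hswap : ∀ vi, ∫ ω, (∫ s, g (ω, (vi, s)) ∂(σ i vi)) ∂μ =
      ∫ s, (∫ ω, g (ω, (vi, s)) ∂μ) ∂(σ i vi) := fun vi =>
    integral_integral_swap (f := fun ω s => g (ω, (vi, s))) <|
      Integrable.of_bound (hg.comp (measurable_fst.prodMk
        (measurable_const.prodMk measurable_snd))).aestronglyMeasurable K
        (ae_of_all _ fun p => hgK _)
  have hG : Integrable (fun y => ∫ ω, g (ω, y) ∂μ) (F i ⊗ₘ σ i) := hgint.integral_prod_right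
  change Integrable (fun vi => ∫ ω, (∫ s, g (ω, (vi, s)) ∂(σ i vi)) ∂μ) (F i) ∧
    ∫ vi, (∫ ω, (∫ s, g (ω, (vi, s)) ∂(σ i vi)) ∂μ) ∂(F i) = _
  simp only [hswap]
  have hGi : Integrable (fun y => ∫ ω, g (ω, y) ∂μ)
      ((Kernel.const Unit (F i) ⊗ₖ Kernel.prodMkLeft Unit (σ i)) ()) := hG
  refine ⟨by simpa using hGi.integral_compProd, ?_⟩
  rw [← Measure.integral_compProd hG, ← integral_integral_swap (f := fun ω y => g (ω, y)) hgint,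
    integral_integral (f := fun ω y => g (ω, y)) hgint]
  have hmp := measurePreserving_pi_update (fun l => F l ⊗ₘ σ l) i
  have hmeas : Measurable fun ω : Fin n → V × S => u (fun j => (ω j).2) (ω i).1 :=
    hu.comp ((measurable_pi_lambda _ fun j => measurable_snd.comp (measurable_pi_apply j)).prodMk
      (measurable_fst.comp (measurable_pi_apply i)))
  rw [hμ, playLaw]
  conv_rhs => rw [← hmp.map_eq]
  rw [integral_map hmp.measurable.aemeasurable hmeas.aestronglyMeasurable]
  refine integral_congr_ae (ae_of_all _ fun p => ?_)
  have h : (fun j => (Function.update p.1 i p.2 j).2) =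
      Function.update (fun j => (p.1 j).2) i p.2.2 := by
    funext j
    by_cases hj : j = i
    · subst hj; simp
    · simp [hj]
  simp only [h, Function.update_self, g]

/-- Smoothness carries over to Bayes-Nash equilibria. The deviations of the players may depend on
the valuation profile `v`: comparing, for each fixed `v`, the equilibrium utility of player `i` with
valuation `v i` against fresh copies of the others with that of his deviation, and summing over the
players, the smoothness inequality applies to the fresh profile of strategies. -/
lemma integral_welfare_ge (M : Mechanism n S V)
    (hu : ∀ i, Measurable fun p : (Fin n → S) × V => M.utility i p.1 p.2)
    (hR : Measurable M.revenue) (hO : Measurable M.optimum) {K : ℝ}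
    (huK : ∀ i s v, |M.utility i s v| ≤ K) (hRK : ∀ s, |M.revenue s| ≤ K)
    (hOK : ∀ v, |M.optimum v| ≤ K)
    (hwel : ∀ s v, M.welfare s v = ∑ i, M.utility i s (v i) + M.revenue s) {e : ℝ}
    (hsmooth : ∀ v, ∃ sStar : Fin n → S, ∀ s, M.optimum v - M.revenue s - e ≤
      ∑ i, M.utility i (Function.update s i (sStar i)) (v i))
    (F : Fin n → Measure V) (σ : Fin n → Kernel V S) [∀ i, IsProbabilityMeasure (F i)]
    [∀ i, IsMarkovKernel (σ i)] (hBN : IsBayesNash M F σ) :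
    ∫ v, M.optimum v ∂(Measure.pi F) - e ≤
      ∫ ω, M.welfare (fun i => (ω i).2) (fun i => (ω i).1) ∂(playLaw F σ) := by
  have : IsProbabilityMeasure (playLaw F σ) := by unfold playLaw; infer_instance
  set μ := playLaw F σ with hμ
  set U : Fin n → V → ℝ := fun i vi =>
    ∫ ω, (∫ s, M.utility i (Function.update (fun j => (ω j).2) i s) vi ∂(σ i vi)) ∂μ with hU
  have hUi := fun i => integral_equilibrium_utility (M.utility i) (hu i) (huK i) F σ i
  have hbids : Measurable fun ω : Fin n → V × S => fun j => (ω j).2 :=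
    measurable_pi_lambda _ fun j => measurable_snd.comp (measurable_pi_apply j)
  have hRint : Integrable (fun ω : Fin n → V × S => M.revenue fun j => (ω j).2) μ :=
    Integrable.of_bound (hR.comp hbids).aestronglyMeasurable K (ae_of_all _ fun ω => hRK _)
  have hdev : ∀ i vi s', Integrable
      (fun ω : Fin n → V × S => M.utility i (Function.update (fun j => (ω j).2) i s') vi) μ := by
    intro i vi s'
    refine Integrable.of_bound (Measurable.aestronglyMeasurable ?_) K
      (ae_of_all _ fun ω => huK _ _ _)
    have h1 : Measurable fun ω : Fin n → V × S => Function.update (fun j => (ω j).2) i s' := by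
      refine measurable_pi_lambda _ fun j => ?_
      by_cases h : j = i
      · subst h; simp
      · simpa [h, Function.comp_def] using measurable_snd.comp (measurable_pi_apply j)
    exact (hu i).comp (h1.prodMk measurable_const)
  have hae : ∀ᵐ v ∂(Measure.pi F),
      M.optimum v - ((∫ ω, M.revenue (fun j => (ω j).2) ∂μ) + e) ≤ ∑ i, U i (v i) := by
    have h1 : ∀ᵐ v ∂(Measure.pi F), ∀ i, ∀ s' : S,
        ∫ ω, M.utility i (Function.update (fun j => (ω j).2) i s') (v i) ∂μ ≤ U i (v i) :=
      ae_all_iff.2 fun i => (measurePreserving_eval F i).quasiMeasurePreserving.ae (hBN i)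
    filter_upwards [h1] with v hv
    obtain ⟨sStar, hs⟩ := hsmooth v
    refine le_trans ?_ (Finset.sum_le_sum fun i _ => hv i (sStar i))
    rw [← integral_finsetSum _ fun i _ => hdev i _ _]
    have h2 : M.optimum v - ((∫ ω, M.revenue (fun j => (ω j).2) ∂μ) + e) =
        ∫ ω, (M.optimum v - e - M.revenue (fun j => (ω j).2)) ∂μ := by
      rw [integral_sub (integrable_const _) hRint]
      simp
      ring
    rw [h2]
    refine integral_mono ((integrable_const _).sub hRint)
      (integrable_finsetSum _ fun i _ => hdev i _ _) fun ω => ?_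
    have := hs fun j => (ω j).2
    linarith
  have hOint : Integrable M.optimum (Measure.pi F) :=
    Integrable.of_bound hO.aestronglyMeasurable K (ae_of_all _ hOK)
  have hUint : ∀ i, Integrable (fun v : Fin n → V => U i (v i)) (Measure.pi F) := fun i =>
    (measurePreserving_eval F i).integrable_comp_of_integrable (hUi i).1
  have hint := integral_mono_ae (hOint.sub (integrable_const _))
    (integrable_finsetSum _ fun i _ => hUint i) hae
  rw [integral_finsetSum _ fun i _ => hUint i] at hint
  have hUeq : ∀ i, ∫ v : Fin n → V, U i (v i) ∂(Measure.pi F) =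
      ∫ ω, M.utility i (fun j => (ω j).2) (ω i).1 ∂μ := fun i => by
    rw [← (hUi i).2]
    have hmp := measurePreserving_eval F i
    conv_rhs => rw [← hmp.map_eq]
    refine (integral_map hmp.measurable.aemeasurable ?_).symm
    rw [hmp.map_eq]
    exact (hUi i).1.aestronglyMeasurable
  simp only [hUeq] at hint
  have hui : ∀ i, Integrable (fun ω : Fin n → V × S => M.utility i (fun j => (ω j).2) (ω i).1) μ :=
    fun i => Integrable.of_bound ((hu i).comp (hbids.prodMk (measurable_fst.comp
      (measurable_pi_apply i)))).aestronglyMeasurable K (ae_of_all _ fun ω => huK _ _ _)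
  simp only [hwel]
  rw [integral_add (integrable_finsetSum _ fun i _ => hui i) hRint,
    integral_finsetSum _ fun i _ => hui i]
  rw [integral_sub' hOint (integrable_const _), integral_const, probReal_univ, one_smul] at hint
  linarith

end Extension

/-! ### Measurability and boundedness of the auction -/

section Measurability

variable {n m r : ℕ} {ρ H B δ : ℝ}

lemma measurable_card_filter {α ι : Type*} [MeasurableSpace α] [Fintype ι] (P : α → ι → Prop)
    [∀ a, DecidablePred (P a)] (hP : ∀ i, MeasurableSet {a | P a i}) :
    Measurable fun a => (Finset.univ.filter (P a)).card := by
  simp only [Finset.card_filter]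
  exact Finset.measurable_fun_sum _ fun i _ =>
    Measurable.ite (hP i) measurable_const measurable_const

lemma measurable_arrivingBids (z : Fin n → Bool) (j : Fin m) (i : Fin n) (x : Fin r) :
    Measurable fun b : Fin n → BidVector m r B => arrivingBids b z j i x := by
  unfold arrivingBids
  split_ifs
  · exact (measurable_pi_apply x).comp ((measurable_pi_apply j).comp
      (measurable_subtype_coe.comp (measurable_pi_apply i)))
  · exact measurable_const

lemma measurable_unitPrice (a : ℕ) (z : Fin n → Bool) (j : Fin m) :
    Measurable fun b : Fin n → BidVector m r B => unitPrice a (arrivingBids b z j) := by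
  classical
  refine measurable_of_Ici fun t => ?_
  rcases le_or_gt t 0 with ht | ht
  · convert MeasurableSet.univ
    exact Set.eq_univ_of_forall fun b => ht.trans (unitPrice_nonneg (arrivingBids_nonneg b z j) a)
  · have h : (fun b : Fin n → BidVector m r B => unitPrice a (arrivingBids b z j)) ⁻¹' Set.Ici t =
        (fun b => (bidsAtLeast (arrivingBids b z j) t).card) ⁻¹' Set.Ioi a := by
      ext b
      exact le_unitPrice_iff ht
    rw [h]
    exact measurable_card_filter (fun (b : Fin n → BidVector m r B) (p : Fin n × Fin r) =>
      t ≤ arrivingBids b z j p.1 p.2) (fun p => measurableSet_le measurable_const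
        (measurable_arrivingBids z j p.1 p.2)) measurableSet_Ioi

lemma measurable_unitsWon (k : ℕ) (π : Equiv.Perm (Fin n)) (z : Fin n → Bool) (j : Fin m)
    (i : Fin n) :
    Measurable fun b : Fin n → BidVector m r B => unitsWon k π (arrivingBids b z j) i := by
  classical
  have hβ := measurable_arrivingBids (n := n) (m := m) (r := r) (B := B) z j
  have hrank : ∀ p, Measurable fun b : Fin n → BidVector m r B =>
      bidRank π (arrivingBids b z j) p := fun p =>
    measurable_card_filter (fun (b : Fin n → BidVector m r B) (q : Fin n × Fin r) =>
      beats π (arrivingBids b z j) q p) fun q =>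
        (measurableSet_lt (hβ _ _) (hβ _ _)).union
          ((measurableSet_eq_fun (hβ _ _) (hβ _ _)).inter (MeasurableSet.const _))
  simp only [unitsWon_eq]
  exact measurable_card_filter (fun (b : Fin n → BidVector m r B) (x : Fin r) =>
    0 < arrivingBids b z j i x ∧ bidRank π (arrivingBids b z j) (i, x) < k) fun x =>
      (measurableSet_lt measurable_const (hβ _ _)).inter (hrank (i, x) measurableSet_Iio)

lemma measurable_bundleWon (k : Fin m → ℕ) (z : Fin n → Bool) (π : Fin m → Equiv.Perm (Fin n))
    (i : Fin n) : Measurable fun b : Fin n → BidVector m r B => bundleWon k b z π i :=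
  measurable_pi_lambda _ fun j => measurable_unitsWon (k j) (π j) z j i

lemma measurable_payment (k : Fin m → ℕ) (z : Fin n → Bool) (π : Fin m → Equiv.Perm (Fin n))
    (i : Fin n) : Measurable fun b : Fin n → BidVector m r B => payment k b z π i :=
  Finset.measurable_fun_sum _ fun j _ => (measurable_from_top.comp
    (measurable_unitsWon (k j) (π j) z j i)).mul (measurable_unitPrice (k j) z j)

lemma measurable_bundleValuation_apply (x : Fin m → ℕ) :
    Measurable fun v : BundleValuation m r ρ H => v.1 x :=
  (measurable_pi_apply x).comp measurable_subtype_coe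

lemma measurable_arrivalExpectation {α : Type*} [MeasurableSpace α]
    {f : α → (Fin n → Bool) → ℝ} (hf : ∀ z, Measurable fun a => f a z) :
    Measurable fun a => arrivalExpectation δ (f a) :=
  Finset.measurable_fun_sum _ fun z _ => (hf z).const_mul _

lemma measurable_orderExpectation {α : Type*} [MeasurableSpace α]
    {f : α → (Fin m → Equiv.Perm (Fin n)) → ℝ} (hf : ∀ π, Measurable fun a => f a π) :
    Measurable fun a => orderExpectation (f a) :=
  (Finset.measurable_fun_sum _ fun π _ => hf π).div_const _

lemma measurable_utility (k : Fin m → ℕ) (i : Fin n) :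
    Measurable fun p : (Fin n → BidVector m r B) × BundleValuation m r ρ H =>
      (noisyUniformPriceAuction n m r ρ H B δ k).utility i p.1 p.2 := by
  refine measurable_arrivalExpectation fun z => measurable_orderExpectation fun π => ?_
  split_ifs
  · refine Measurable.sub ?_ ((measurable_payment k z π i).comp measurable_fst)
    have h : Measurable fun p : BundleValuation m r ρ H × (Fin m → ℕ) => p.1.1 p.2 :=
      measurable_from_prod_countable_left measurable_bundleValuation_apply
    exact h.comp (measurable_snd.prodMk ((measurable_bundleWon k z π i).comp measurable_fst))
  · exact measurable_const

lemma measurable_revenue (k : Fin m → ℕ) :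
    Measurable (noisyUniformPriceAuction n m r ρ H B δ k).revenue :=
  measurable_arrivalExpectation fun z => measurable_orderExpectation fun π =>
    Finset.measurable_fun_sum _ fun i _ => measurable_payment k z π i

lemma measurable_optimum (k : Fin m → ℕ) :
    Measurable (noisyUniformPriceAuction n m r ρ H B δ k).optimum := by
  refine measurable_arrivalExpectation fun z => Measurable.iSup fun x =>
    Finset.measurable_fun_sum _ fun i _ => ?_
  split_ifs
  · exact (measurable_bundleValuation_apply _).comp (measurable_pi_apply i)
  · exact measurable_const

lemma payment_nonneg (k : Fin m → ℕ) (s : Fin n → BidVector m r B) (z : Fin n → Bool)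
    (π : Fin m → Equiv.Perm (Fin n)) (i : Fin n) : 0 ≤ payment k s z π i :=
  Finset.sum_nonneg fun j _ => mul_nonneg (Nat.cast_nonneg _)
    (unitPrice_nonneg (arrivingBids_nonneg s z j) _)

lemma payment_le (hB : 0 ≤ B) (k : Fin m → ℕ) (s : Fin n → BidVector m r B) (z : Fin n → Bool)
    (π : Fin m → Equiv.Perm (Fin n)) (i : Fin n) : payment k s z π i ≤ m * (r * B) := by
  refine (Finset.sum_le_card_nsmul _ _ (r * B) fun j _ => ?_).trans_eq (by simp)
  exact mul_le_mul (Nat.cast_le.2 (unitsWon_le _ _ _ _)) (unitPrice_le hB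
    (arrivingBids_le hB s z j) _) (unitPrice_nonneg (arrivingBids_nonneg s z j) _)
    (Nat.cast_nonneg _)

/-- A player who does not arrive has only null bids and pays nothing. -/
lemma payment_eq_zero (k : Fin m → ℕ) (s : Fin n → BidVector m r B) {z : Fin n → Bool}
    (π : Fin m → Equiv.Perm (Fin n)) {i : Fin n} (hz : z i = false) : payment k s z π i = 0 := by
  refine Finset.sum_eq_zero fun j _ => ?_
  have : bundleWon k s z π i j = 0 := by
    simp [bundleWon, unitsWon_eq, arrivingBids, hz]
  simp [this]

lemma abs_expectation_le (hδ0 : 0 ≤ δ) (hδ1 : δ ≤ 1) {K : ℝ}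
    {f : (Fin n → Bool) → (Fin m → Equiv.Perm (Fin n)) → ℝ} (hf : ∀ z π, |f z π| ≤ K) :
    |arrivalExpectation δ fun z => orderExpectation (f z)| ≤ K := by
  refine abs_le.2 ⟨?_, ?_⟩
  · rw [← arrivalExpectation_const (n := n) (δ := δ) (-K)]
    refine arrivalExpectation_mono hδ0 hδ1 fun z => ?_
    rw [← orderExpectation_const (n := n) (m := m) (-K)]
    exact orderExpectation_mono fun π => (abs_le.1 (hf z π)).1
  · rw [← arrivalExpectation_const (n := n) (δ := δ) K]
    refine arrivalExpectation_mono hδ0 hδ1 fun z => ?_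
    rw [← orderExpectation_const (n := n) (m := m) K]
    exact orderExpectation_mono fun π => (abs_le.1 (hf z π)).2

lemma abs_utility_le (hH : 0 ≤ H) (hB : 0 ≤ B) (hδ0 : 0 ≤ δ) (hδ1 : δ ≤ 1) (k : Fin m → ℕ)
    (i : Fin n) (s : Fin n → BidVector m r B) (v : BundleValuation m r ρ H) :
    |(noisyUniformPriceAuction n m r ρ H B δ k).utility i s v| ≤ H + m * (r * B) := by
  refine abs_expectation_le hδ0 hδ1 fun z π => ?_
  have h1 := payment_nonneg k s z π i
  have h2 := payment_le hB k s z π i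
  split_ifs
  · have h3 := v.2.1 (bundleWon k s z π i)
    exact abs_le.2 ⟨by linarith, by linarith⟩
  · rw [abs_zero]
    linarith

lemma abs_revenue_le (hB : 0 ≤ B) (hδ0 : 0 ≤ δ) (hδ1 : δ ≤ 1) (k : Fin m → ℕ)
    (s : Fin n → BidVector m r B) :
    |(noisyUniformPriceAuction n m r ρ H B δ k).revenue s| ≤ n * (m * (r * B)) := by
  refine abs_expectation_le hδ0 hδ1 fun z π => ?_
  rw [abs_of_nonneg (Finset.sum_nonneg fun i _ => payment_nonneg k s z π i)]
  exact (Finset.sum_le_card_nsmul _ _ _ fun i _ => payment_le hB k s z π i).trans_eq (by simp)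

lemma optimum_nonneg (hδ0 : 0 ≤ δ) (hδ1 : δ ≤ 1) (k : Fin m → ℕ)
    (v : Fin n → BundleValuation m r ρ H) :
    0 ≤ (noisyUniformPriceAuction n m r ρ H B δ k).optimum v := by
  have := arrivalExpectation_mono hδ0 hδ1 (optimalWelfare_nonneg k v)
  rwa [arrivalExpectation_const] at this

lemma optimum_le (hH : 0 ≤ H) (hδ0 : 0 ≤ δ) (hδ1 : δ ≤ 1) (k : Fin m → ℕ)
    (v : Fin n → BundleValuation m r ρ H) :
    (noisyUniformPriceAuction n m r ρ H B δ k).optimum v ≤ n * H := by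
  have := arrivalExpectation_mono hδ0 hδ1 (optimalWelfare_le hH k v)
  rwa [arrivalExpectation_const] at this

lemma welfare_eq (k : Fin m → ℕ) (s : Fin n → BidVector m r B)
    (v : Fin n → BundleValuation m r ρ H) :
    (noisyUniformPriceAuction n m r ρ H B δ k).welfare s v =
      ∑ i, (noisyUniformPriceAuction n m r ρ H B δ k).utility i s (v i) +
        (noisyUniformPriceAuction n m r ρ H B δ k).revenue s := by
  simp only [noisyUniformPriceAuction]
  rw [← arrivalExpectation_sum, ← arrivalExpectation_add]
  congr 1
  funext z
  rw [← orderExpectation_sum, ← orderExpectation_add]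
  congr 1
  funext π
  rw [← Finset.sum_add_distrib]
  refine Finset.sum_congr rfl fun i _ => ?_
  cases hz : z i
  · simp [payment_eq_zero k s π hz]
  · simp

end Measurability

/-! ### Full efficiency in the limit -/

section Efficiency

variable {n m r : ℕ} {ρ H B δ c : ℝ}

lemma smoothnessError_nonneg (hB : 0 ≤ B) (hδ0 : 0 < δ) (hc : 0 < c) :
    0 ≤ smoothnessError m r H B δ c := by
  unfold smoothnessError
  positivity

/-- An error `e * √n` is the fraction `e / L / √n` of `L * n`. -/
lemma mul_sqrt_eq_rate_mul (hn : 0 < n) {e L : ℝ} (hL : 0 < L) :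
    e * Real.sqrt n = e / L / Real.sqrt n * (L * n) := by
  have hn0 : (0 : ℝ) < n := Nat.cast_pos.2 hn
  have hs : 0 < Real.sqrt n := Real.sqrt_pos.2 hn0
  rw [← Real.mul_self_sqrt hn0.le, Real.sqrt_mul_self hs.le]
  field_simp

/-- Smoothness up to `e * √n` yields efficiency `1 - C / √n`, since the optimal welfare is at least
`L * n`. -/
lemma bayesNashEfficiency_of_large (hm : 0 < m) (hρ : 0 < ρ) (hρH : ρ ≤ H) (hHB : H ≤ B)
    (hδ0 : 0 < δ) (hδ1 : δ < 1) (hc : 0 < c) (hn : 0 < n) {k : Fin m → ℕ} (hk : ∀ j, r ≤ k j)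
    (hkc : ∀ j, c * n / 2 ≤ (k j : ℝ) - r + 1) (hkn : ∀ j, c * n ≤ k j) :
    BayesNashEfficiency (noisyUniformPriceAuction n m r ρ H B δ k)
      (1 - smoothnessError m r H B δ c / ((1 - δ) * (ρ * min c 1)) / Real.sqrt n) := by
  intro F σ hF hσ hBN
  have hH : 0 ≤ H := hρ.le.trans hρH
  have hB : 0 < B := (hρ.trans_le hρH).trans_le hHB
  set M := noisyUniformPriceAuction n m r ρ H B δ k with hM
  set e := smoothnessError m r H B δ c
  set L := (1 - δ) * (ρ * min c 1)
  have hL0 : 0 < L := mul_pos (by linarith) (mul_pos hρ (lt_min hc one_pos))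
  have he : 0 ≤ e := smoothnessError_nonneg hB.le hδ0 hc
  have hn0 : (0 : ℝ) < n := Nat.cast_pos.2 hn
  set K := H + m * (r * B) + n * (m * (r * B)) + n * H with hK
  have hmrB : 0 ≤ (m : ℝ) * (r * B) := by positivity
  have hnm : 0 ≤ (n : ℝ) * (m * (r * B)) := by positivity
  have hnH : 0 ≤ n * H := by positivity
  have hOK : ∀ v, |M.optimum v| ≤ K := fun v => by
    rw [abs_of_nonneg (optimum_nonneg hδ0.le hδ1.le k v)]
    exact (optimum_le hH hδ0.le hδ1.le k v).trans (by linarith)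
  have hmain := integral_welfare_ge M (K := K) (e := e * Real.sqrt n)
    (fun i => measurable_utility k i) (measurable_revenue k) (measurable_optimum k)
    (fun i s v => (abs_utility_le hH hB.le hδ0.le hδ1.le k i s v).trans (by linarith))
    (fun s => (abs_revenue_le hB.le hδ0.le hδ1.le k s).trans (by linarith)) hOK
    (fun s v => welfare_eq k s v) (exists_smooth_deviation hB hHB hδ0 hδ1 hc hn hk hkc) F σ hBN
  refine le_trans ?_ hmain
  have hopt : L * n ≤ ∫ v, M.optimum v ∂(Measure.pi F) := by
    have h1 : ∀ v, L * n ≤ M.optimum v := linear_le_optimum hρ.le hδ0.le hδ1.le (hkn ⟨0, hm⟩)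
    have h2 := integral_mono (μ := Measure.pi F) (integrable_const (L * n))
      (Integrable.of_bound (measurable_optimum k).aestronglyMeasurable K (ae_of_all _ hOK)) h1
    simpa using h2
  have h3 : e * Real.sqrt n ≤ e / L / Real.sqrt n * ∫ v, M.optimum v ∂(Measure.pi F) := by
    rw [mul_sqrt_eq_rate_mul hn hL0]
    exact mul_le_mul_of_nonneg_left hopt (by positivity)
  rw [sub_mul, one_mul]
  linarith

lemma BayesNashEfficiency.mono (hδ0 : 0 ≤ δ) (hδ1 : δ ≤ 1) {k : Fin m → ℕ} {α α' : ℝ}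
    (h : BayesNashEfficiency (noisyUniformPriceAuction n m r ρ H B δ k) α) (hα : α' ≤ α) :
    BayesNashEfficiency (noisyUniformPriceAuction n m r ρ H B δ k) α' :=
  fun F σ hF hσ hBN => le_trans (mul_le_mul_of_nonneg_right hα
    (integral_nonneg fun v => optimum_nonneg hδ0 hδ1 k v)) (h F σ hF hσ hBN)

end Efficiency

theorem mainTheorem4 (m r : ℕ) (hm : 0 < m) (hr : 0 < r) (ρ H B δ c : ℝ)
    (hρ : 0 < ρ) (hρH : ρ ≤ H) (hHB : H ≤ B) (hδ0 : 0 < δ) (hδ1 : δ < 1) (hc : 0 < c) :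
    ∃ C : ℝ, ∀ k : ℕ → Fin m → ℕ, (∀ᶠ n : ℕ in atTop, ∀ j, c * (n : ℝ) ≤ (k n j : ℝ)) →
      SmoothInTheLarge (fun n => noisyUniformPriceAuction n m r ρ H B δ (k n)) 1 1 ∧
      (∀ ε : ℝ, 0 < ε → ∀ᶠ n : ℕ in atTop,
        BayesNashEfficiency (noisyUniformPriceAuction n m r ρ H B δ (k n)) (1 - ε)) ∧
      (∀ᶠ n : ℕ in atTop,
        BayesNashEfficiency (noisyUniformPriceAuction n m r ρ H B δ (k n))
          (1 - C / Real.sqrt (n : ℝ))) := by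
  have hB : 0 < B := (hρ.trans_le hρH).trans_le hHB
  set e := smoothnessError m r H B δ c
  set L := (1 - δ) * (ρ * min c 1)
  have hL0 : 0 < L := mul_pos (by linarith) (mul_pos hρ (lt_min hc one_pos))
  refine ⟨e / L, fun k hk => ?_⟩
  have hlarge : ∀ᶠ n : ℕ in atTop, 0 < n ∧ ∀ j, r ≤ k n j ∧
      c * n / 2 ≤ (k n j : ℝ) - r + 1 ∧ c * n ≤ k n j := by
    filter_upwards [hk, eventually_gt_atTop 0,
      (tendsto_natCast_atTop_atTop (R := ℝ)).eventually_ge_atTop (2 * r / c)] with n hkn hn hnr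
    refine ⟨hn, fun j => ?_⟩
    have h1 : 2 * (r : ℝ) ≤ c * n := by
      rw [div_le_iff₀ hc] at hnr
      linarith
    have h2 := hkn j
    have h3 : (0 : ℝ) ≤ r := Nat.cast_nonneg r
    exact ⟨Nat.cast_le.1 (by linarith : (r : ℝ) ≤ k n j), by linarith, h2⟩
  have hsmall : ∀ ε : ℝ, 0 < ε → ∀ᶠ n : ℕ in atTop, e / L / Real.sqrt n ≤ ε := fun ε hε => by
    have h : Tendsto (fun n : ℕ => e / L / Real.sqrt n) atTop (nhds 0) :=
      tendsto_const_nhds.div_atTop (Real.tendsto_sqrt_atTop.comp tendsto_natCast_atTop_atTop)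
    exact h.eventually (ge_mem_nhds hε)
  have hrate : ∀ᶠ n : ℕ in atTop, BayesNashEfficiency
      (noisyUniformPriceAuction n m r ρ H B δ (k n)) (1 - e / L / Real.sqrt (n : ℝ)) := by
    filter_upwards [hlarge] with n hn
    exact bayesNashEfficiency_of_large hm hρ hρH hHB hδ0 hδ1 hc hn.1 (fun j => (hn.2 j).1)
      (fun j => (hn.2 j).2.1) fun j => (hn.2 j).2.2
  refine ⟨fun ε hε => ?_, fun ε hε => ?_, hrate⟩
  · obtain ⟨N, hN⟩ := eventually_atTop.1 (hlarge.and (hsmall ε hε))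
    refine ⟨N, fun n hn v => ?_⟩
    obtain ⟨⟨hn0, hkn⟩, hεn⟩ := hN n hn.le
    obtain ⟨sStar, hs⟩ := exists_smooth_deviation hB hHB hδ0 hδ1 hc hn0 (fun j => (hkn j).1)
      (fun j => (hkn j).2.1) v
    refine ⟨sStar, fun s => le_trans ?_ (hs s)⟩
    have hopt : L * n ≤ (noisyUniformPriceAuction n m r ρ H B δ (k n)).optimum v :=
      linear_le_optimum hρ.le hδ0.le hδ1.le (hkn ⟨0, hm⟩).2.2 v
    have herr : e * Real.sqrt n ≤ ε * (L * n) := by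
      rw [mul_sqrt_eq_rate_mul hn0 hL0]
      exact mul_le_mul_of_nonneg_right hεn (by positivity)
    have h2 := mul_le_mul_of_nonneg_left hopt hε.le
    linarith
  · filter_upwards [hrate, hsmall ε hε] with n hn hεn
    exact hn.mono hδ0.le hδ1.le (by linarith)
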